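/- Let $k$ be a field of characteristic zero, $R=k[x_1,\dots,x_n]$, and let $f\in R$ be a squarefree homogeneous polynomial of degree $d\ge 2$. Put $A=R/(f)$, $\mathbf F=\mathrm{Der}_k(R)=\bigoplus_i R\,\partial/\partial x_i\simeq R^n$, $\mathbf E=\mathrm{Der}_f(R)=\{\delta\in \mathrm{Der}_k(R) : \delta((f))\subseteq (f)\}\subseteq\mathbf F$, and $E=\mathrm{Der}_k(A)\subseteq F=\bigoplus_i A\,\partial/\partial x_i$, embedded by $\delta\mapsto(\delta(x_1),\dots,\delta(x_n))$. Assume that $f$ is a free divisor, i.e. that $\mathbf E$ is a free $R$-module. For a module $M$ over a ring $B$, let $\mathcal S_B(M)$ be its symmetric algebra and $\mathcal R_B(M)$ its Rees algebra, the quotient of $\mathcal S_B(M)$ by its $B$-torsion. For a surjection $R'\to A$ from a $k$-algebra $R'$ of finite type, let $\mathbf E_{R'}\subseteq R'^n$ be the inverse image of $E\subseteq A^n$ and let $$\mathcal A_{R'\to A}(E)=\mathcal S_A(E)\otimes_{\mathcal S_{R'}(\mathbf E_{R'})}\mathcal R_{R'}(\mathbf E_{R'})$$ be the $R'$-embedded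 Aluffi algebra of $E$; it is a quotient of $\mathcal S_A(E)$. The absolute Aluffi algebra $\mathcal A_A(E)$ is the inverse limit of the algebras $\mathcal A_{R'\to A}(E)$ over all such surjections $R'\to A$, with respect to the surjections $R'\to R''$ over $A$. For $R'=R$ one has $\mathbf E_R=\mathbf E$. (a) The canonical maps $\mathcal S_A(E)\to\mathcal A_{R\to A}(E)$ and $\mathcal S_A(E)\to\mathcal A_A(E)$ are isomorphisms. Moreover, $\mathbf E$ has a basis of $n$ elements, and for every ordered basis $e_1,\dots,e_n$ of $\mathbf E$, with $\mathcal E=(e_j(x_i))_{i,j}$ the $n\times n$ matrix over $R$ whose columns are the basis vectors, the following hold. (b) The $R$-algebra map $R[U_1,\dots,U_n]\to\mathcal R_R(\mathbf E)$, $U_j\mapsto e_j$, is an isomorphism, and its composite with the canonical map to $\mathcal A_{R\to A}(E)$ is surjective. Let $\mathfrak A\subseteq R[U_1,\dots,U_n]$ be the kernel of this composite. Then $\mathfrak A$ has codimension (height) $2$ and is perfect, i.e. the projective dimension of $R[U_1,\dots,U_n]/\mathfrak A$ equals the grade of $\mathfrak A$. For a suitable choice of $n+1$ generators of $\mathfrak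 A$, the $(n+1)\times n$ matrix $$\begin{pmatrix} U_1\ \cdots\ U_n\\ \mathcal E\end{pmatrix}$$ is its presentation matrix (its columns generate the module of relations), and the linear map $R[U_1,\dots,U_n]^n\to R[U_1,\dots,U_n]^{n+1}$ that it defines is injective. If each $e_j$ is homogeneous, in the sense that all its coordinates $e_j(x_1),\dots,e_j(x_n)$ are homogeneous of the same degree $w_j$, then $\mathfrak A$ is homogeneous for the grading of $R[U_1,\dots,U_n]$ in which each $x_i$ has weight $1$ and $U_j$ has weight $w_j$. (c) As an $R$-module, $E=\mathrm{Der}_k(A)$ has projective dimension $1$. The derivations of $A$ induced by $e_1,\dots,e_n$ generate $E$, and the presentation matrix of $E$ with respect to these generators, its columns being the relations, is the $n\times n$ adjugate matrix of $\mathcal E$ (the transposed matrix of cofactors), which defines an injective map $R^n\to R^n$. -/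

import Mathlib

open MvPolynomial TensorProduct

universe u

noncomputable section

/-! ### Rees algebra of a module -/

/-- The ideal of `R`-torsion elements of the symmetric algebra `S_R(M)`: those killed by some
nonzerodivisor of `R`. -/
def symTorsion (R M : Type*) [CommRing R] [AddCommGroup M] [Module R M] :
    Ideal (SymmetricAlgebra R M) where
  carrier := {z | ∃ a ∈ nonZeroDivisors R, a • z = 0}
  zero_mem' := ⟨1, one_mem _, smul_zero _⟩
  add_mem' := by
    rintro x y ⟨a, ha, hx⟩ ⟨b, hb, hy⟩
    refine ⟨a * b, mul_mem ha hb, ?_⟩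
    rw [smul_add, mul_comm a b, mul_smul, hx, smul_zero, mul_comm b a, mul_smul, hy, smul_zero,
      add_zero]
  smul_mem' := by
    rintro c x ⟨a, ha, hx⟩
    exact ⟨a, ha, by rw [smul_eq_mul, ← mul_smul_comm, hx, mul_zero]⟩

/-- The Rees algebra of a module: its symmetric algebra modulo `R`-torsion. -/
abbrev ReesAlgebra (R M : Type*) [CommRing R] [AddCommGroup M] [Module R M] : Type _ :=
  SymmetricAlgebra R M ⧸ symTorsion R M

/-! ### Deformations and Aluffi algebras -/

/-- An embedding of the `A`-module `E` into the free module `A^ι`. A module which has one is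
torsion-free. -/
structure FreeEmbedding (A E ι : Type*) [CommRing A] [AddCommGroup E] [Module A E] where
  /-- the underlying linear map -/
  toLin : E →ₗ[A] (ι → A)
  injective : Function.Injective toLin

section Deformation

variable (R : Type*) {A E ι : Type*} [CommRing R] [CommRing A] [Algebra R A]
  [AddCommGroup E] [Module A E] (φ : FreeEmbedding A E ι)

/-- The torsion-free deformation of `E ⊆ A^ι` along (a surjection) `R → A`: the inverse image of
`E` under the coordinatewise map `R^ι → A^ι`. -/
def deformation : Submodule R (ι → R) :=
  ((LinearMap.range φ.toLin).restrictScalars R).comap ((Algebra.linearMap R A).compLeft ι)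

theorem mem_deformation {v : ι → R} :
    v ∈ deformation R φ ↔ ∃ x : E, ∀ i, φ.toLin x i = algebraMap R A (v i) := by
  simp only [deformation, Submodule.mem_comap, Submodule.restrictScalars_mem,
    LinearMap.mem_range, funext_iff, LinearMap.compLeft_apply, Function.comp_apply,
    Algebra.linearMap_apply]

/-- The map from the deformation to `E`, semilinear along `R → A`. -/
def deformationMap : deformation R φ →ₛₗ[algebraMap R A] E where
  toFun v := ((mem_deformation R φ).1 v.2).choose
  map_add' v w := φ.injective <| funext fun i => by
    rw [((mem_deformation R φ).1 (v + w).2).choose_spec i, map_add, Pi.add_apply,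
      ((mem_deformation R φ).1 v.2).choose_spec i, ((mem_deformation R φ).1 w.2).choose_spec i]
    simp
  map_smul' r v := φ.injective <| funext fun i => by
    rw [((mem_deformation R φ).1 (r • v).2).choose_spec i, map_smul, Pi.smul_apply,
      ((mem_deformation R φ).1 v.2).choose_spec i]
    simp

theorem deformationMap_spec (v : deformation R φ) (i : ι) :
    φ.toLin (deformationMap R φ v) i = algebraMap R A (v.1 i) :=
  ((mem_deformation R φ).1 v.2).choose_spec i

/-- The ring homomorphism `S_R(𝐄) → S_A(E)` induced by `R → A` and by `𝐄 → E`, where `𝐄` is the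
deformation of `E`. -/
def symDeformationMap : SymmetricAlgebra R (deformation R φ) →+* SymmetricAlgebra A E :=
  letI : Algebra R (SymmetricAlgebra A E) :=
    ((algebraMap A (SymmetricAlgebra A E)).comp (algebraMap R A)).toAlgebra
  (SymmetricAlgebra.lift (R := R) (M := deformation R φ) (A := SymmetricAlgebra A E)
    { toFun := fun v => SymmetricAlgebra.ι A E (deformationMap R φ v)
      map_add' := fun v w => by rw [map_add, map_add]
      map_smul' := fun r v => by
        rw [LinearMap.map_smulₛₗ, LinearMap.map_smul, Algebra.smul_def, Algebra.smul_def]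
        rfl }).toRingHom

theorem symDeformationMap_ι (v : deformation R φ) :
    symDeformationMap R φ (SymmetricAlgebra.ι R _ v) =
      SymmetricAlgebra.ι A E (deformationMap R φ v) := by
  let _ : Algebra R (SymmetricAlgebra A E) :=
    ((algebraMap A (SymmetricAlgebra A E)).comp (algebraMap R A)).toAlgebra
  exact SymmetricAlgebra.lift_ι_apply (R := R) (A := SymmetricAlgebra A E) _ v

theorem symDeformationMap_algebraMap (r : R) :
    symDeformationMap R φ (algebraMap R _ r) =
      algebraMap A (SymmetricAlgebra A E) (algebraMap R A r) := by
  let _ : Algebra R (SymmetricAlgebra A E) :=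
    ((algebraMap A (SymmetricAlgebra A E)).comp (algebraMap R A)).toAlgebra
  exact AlgHom.commutes (SymmetricAlgebra.lift (R := R) (A := SymmetricAlgebra A E) _) r

instance symDeformationAlgebra :
    Algebra (SymmetricAlgebra R (deformation R φ)) (SymmetricAlgebra A E) :=
  (symDeformationMap R φ).toAlgebra

/-- The `R`-embedded Aluffi algebra `S_A(E) ⊗_{S_R(𝐄)} Rees_R(𝐄)` of `E`, where `𝐄` is the
deformation of `E` along `R → A`. -/
def EmbeddedAluffi : Type _ :=
  SymmetricAlgebra A E ⊗[SymmetricAlgebra R (deformation R φ)] ReesAlgebra R (deformation R φ)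

instance : CommRing (EmbeddedAluffi R φ) :=
  inferInstanceAs (CommRing (SymmetricAlgebra A E ⊗[SymmetricAlgebra R (deformation R φ)]
    ReesAlgebra R (deformation R φ)))

/-- The canonical map `s ↦ s ⊗ 1` from the symmetric algebra to the embedded Aluffi algebra. -/
def symToAluffi : SymmetricAlgebra A E →+* EmbeddedAluffi R φ :=
  (Algebra.TensorProduct.includeLeftRingHom :
    SymmetricAlgebra A E →+* SymmetricAlgebra A E ⊗[SymmetricAlgebra R (deformation R φ)]
      ReesAlgebra R (deformation R φ))

/-- The canonical map `x ↦ 1 ⊗ x` from the Rees algebra of the deformation to the embedded Aluffi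
algebra. -/
def reesToAluffi : ReesAlgebra R (deformation R φ) →+* EmbeddedAluffi R φ :=
  (Algebra.TensorProduct.includeRight :
    ReesAlgebra R (deformation R φ) →ₐ[SymmetricAlgebra R (deformation R φ)]
      SymmetricAlgebra A E ⊗[SymmetricAlgebra R (deformation R φ)]
        ReesAlgebra R (deformation R φ)).toRingHom

end Deformation

/-- A surjection `R → A` from a `k`-algebra `R` of finite type. -/
structure FiniteTypeCover (k A : Type u) [Field k] [CommRing A] [Algebra k A] where
  R : Type u
  [commRing : CommRing R]
  [algebraBase : Algebra k R]
  [finiteType : Algebra.FiniteType k R]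
  [algebra : Algebra R A]
  [isScalarTower : IsScalarTower k R A]
  surjective : Function.Surjective (algebraMap R A)

attribute [instance] FiniteTypeCover.commRing FiniteTypeCover.algebraBase
  FiniteTypeCover.finiteType FiniteTypeCover.algebra FiniteTypeCover.isScalarTower

/-- The absolute Aluffi algebra of `E ⊆ A^ι`: the inverse limit of the embedded Aluffi algebras
over all `k`-algebras of finite type that surject onto `A`, the index maps being the surjections
`R → R'` over `A`. Every embedded Aluffi algebra is a quotient of `S_A(E)` and the transition maps
are maps of quotients of `S_A(E)`, so `x` is sent to `x'` exactly if the two have a common lift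
to `S_A(E)`. -/
def AbsoluteAluffi (k : Type u) {A : Type u} {E ι : Type*} [Field k] [CommRing A] [Algebra k A]
    [AddCommGroup E] [Module A E] (φ : FreeEmbedding A E ι) :
    Subring (∀ C : FiniteTypeCover k A, EmbeddedAluffi C.R φ) where
  carrier := {x | ∀ (C D : FiniteTypeCover k A) (g : C.R →ₐ[k] D.R), Function.Surjective g →
    (∀ r, algebraMap D.R A (g r) = algebraMap C.R A r) →
    ∃ s : SymmetricAlgebra A E, symToAluffi C.R φ s = x C ∧ symToAluffi D.R φ s = x D}
  mul_mem' := by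
    intro x y hx hy C D g hg hgA
    obtain ⟨s, hs, hs'⟩ := hx C D g hg hgA
    obtain ⟨t, ht, ht'⟩ := hy C D g hg hgA
    exact ⟨s * t, by rw [map_mul, hs, ht, Pi.mul_apply], by rw [map_mul, hs', ht', Pi.mul_apply]⟩
  one_mem' := fun _ _ _ _ _ => ⟨1, map_one _, map_one _⟩
  add_mem' := by
    intro x y hx hy C D g hg hgA
    obtain ⟨s, hs, hs'⟩ := hx C D g hg hgA
    obtain ⟨t, ht, ht'⟩ := hy C D g hg hgA
    exact ⟨s + t, by rw [map_add, hs, ht, Pi.add_apply], by rw [map_add, hs', ht', Pi.add_apply]⟩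
  zero_mem' := fun _ _ _ _ _ => ⟨0, map_zero _, map_zero _⟩
  neg_mem' := by
    intro x hx C D g hg hgA
    obtain ⟨s, hs, hs'⟩ := hx C D g hg hgA
    exact ⟨-s, by rw [map_neg, hs, Pi.neg_apply], by rw [map_neg, hs', Pi.neg_apply]⟩

/-- The canonical map from the symmetric algebra to the absolute Aluffi algebra. -/
def symToAbsoluteAluffi (k : Type u) {A : Type u} {E ι : Type*} [Field k] [CommRing A]
    [Algebra k A] [AddCommGroup E] [Module A E] (φ : FreeEmbedding A E ι) :
    SymmetricAlgebra A E →+* AbsoluteAluffi k φ :=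
  (RingHom.pi fun C : FiniteTypeCover k A => symToAluffi C.R φ).codRestrict (AbsoluteAluffi k φ)
    fun s _ _ _ _ _ => ⟨s, rfl, rfl⟩

/-! ### Presentation matrices, grade and perfect ideals -/

/-- `M` is the presentation matrix of the module `N` with respect to the generators `g`: the `g i`
generate `N` and the columns of `M` generate their module of relations, that is,
`S^p --M--> S^m --g--> N → 0` is exact. -/
def IsPresentationMatrix {S N m p : Type*} [CommRing S] [AddCommGroup N] [Module S N]
    [Fintype m] [Fintype p] (M : Matrix m p S) (g : m → N) : Prop :=
  Submodule.span S (Set.range g) = ⊤ ∧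
    LinearMap.ker (Fintype.linearCombination S g) = LinearMap.range M.mulVecLin

/-- The grade of an ideal: the supremum of the lengths of the regular sequences contained in it. -/
def idealGrade {S : Type*} [CommRing S] (I : Ideal S) : ℕ∞ :=
  ⨆ rs : {rs : List S // RingTheory.Sequence.IsRegular S rs ∧ ∀ r ∈ rs, r ∈ I},
    (rs.1.length : ℕ∞)

/-- A perfect ideal: the projective dimension of `S/I` equals the grade of `I`. -/
def IsPerfectIdeal {S : Type u} [CommRing S] (I : Ideal S) : Prop :=
  CategoryTheory.projectiveDimension (ModuleCat.of S (S ⧸ I)) = ((idealGrade I : ℕ∞) : WithBot ℕ∞)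

/-! ### Derivations of a hypersurface ring -/

section Hypersurface

variable {k : Type u} [Field k] {n : ℕ}

/-- The module of logarithmic derivations: the `k`-derivations `δ` of the polynomial ring with
`δ J ⊆ J`, where `J = (f)`. -/
def logDer (f : MvPolynomial (Fin n) k) :
    Submodule (MvPolynomial (Fin n) k)
      (Derivation k (MvPolynomial (Fin n) k) (MvPolynomial (Fin n) k)) where
  carrier := {δ | ∀ a ∈ Ideal.span {f}, δ a ∈ Ideal.span {f}}
  zero_mem' := fun _ _ => by simp
  add_mem' := fun h h' a ha => by
    rw [Derivation.add_apply]; exact add_mem (h a ha) (h' a ha)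
  smul_mem' := fun r δ h a ha => by
    rw [Derivation.smul_apply]; exact Ideal.mul_mem_left _ r (h a ha)

/-- The coordinate ring `k[x₁, …, xₙ]/(f)`. -/
abbrev HypersurfaceRing (f : MvPolynomial (Fin n) k) : Type u :=
  MvPolynomial (Fin n) k ⧸ Ideal.span {f}

/-- The module `Der_k(k[x₁, …, xₙ]/(f))`. -/
abbrev HypersurfaceDer (f : MvPolynomial (Fin n) k) : Type u :=
  Derivation k (HypersurfaceRing f) (HypersurfaceRing f)

/-- The standard embedding `Der_k(A) ⊆ ⨁ A ∂/∂xᵢ`, `δ ↦ (δ(x₁), …, δ(xₙ))`. -/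
def derEmbedding (f : MvPolynomial (Fin n) k) :
    FreeEmbedding (HypersurfaceRing f) (HypersurfaceDer f) (Fin n) where
  toLin :=
    { toFun := fun δ i => δ (Ideal.Quotient.mk _ (X i))
      map_add' := fun _ _ => rfl
      map_smul' := fun _ _ => rfl }
  injective := by
    intro δ δ' h
    have h2 : δ.compAlgebraMap (MvPolynomial (Fin n) k) =
        δ'.compAlgebraMap (MvPolynomial (Fin n) k) :=
      MvPolynomial.derivation_ext fun i => congrFun h i
    ext a
    obtain ⟨p, rfl⟩ := Ideal.Quotient.mk_surjective a
    exact Derivation.congr_fun h2 p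

theorem logDer_mk_eq_zero (f : MvPolynomial (Fin n) k) (δ : logDer f) (x : MvPolynomial (Fin n) k)
    (hx : Ideal.Quotient.mkₐ k (Ideal.span {f}) x = 0) :
    Ideal.Quotient.mkₐ k (Ideal.span {f}) (δ.1 x) = 0 :=
  Ideal.Quotient.eq_zero_iff_mem.2 (δ.2 x (Ideal.Quotient.eq_zero_iff_mem.1 hx))

/-- The derivation of `k[x]/(f)` induced by a logarithmic derivation. -/
def logDerDescendFun (f : MvPolynomial (Fin n) k) (δ : logDer f) : HypersurfaceDer f :=
  Derivation.liftOfSurjective (f := Ideal.Quotient.mkₐ k (Ideal.span {f}))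
    (Ideal.Quotient.mkₐ_surjective k _) (logDer_mk_eq_zero f δ)

theorem logDerDescendFun_mk (f : MvPolynomial (Fin n) k) (δ : logDer f)
    (p : MvPolynomial (Fin n) k) :
    logDerDescendFun f δ (Ideal.Quotient.mk _ p) = Ideal.Quotient.mk _ (δ.1 p) :=
  Derivation.liftOfSurjective_apply (f := Ideal.Quotient.mkₐ k (Ideal.span {f}))
    (Ideal.Quotient.mkₐ_surjective k _) (logDer_mk_eq_zero f δ) p

/-- The linear map that sends a logarithmic derivation to the derivation of `k[x]/(f)` it
induces. -/
def logDerDescend (f : MvPolynomial (Fin n) k) :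
    logDer f →ₗ[MvPolynomial (Fin n) k] HypersurfaceDer f where
  toFun := logDerDescendFun f
  map_add' δ δ' := by
    ext a
    obtain ⟨p, rfl⟩ := Ideal.Quotient.mk_surjective a
    rw [Derivation.add_apply, logDerDescendFun_mk, logDerDescendFun_mk, logDerDescendFun_mk,
      Submodule.coe_add, Derivation.add_apply, map_add]
  map_smul' r δ := by
    ext a
    obtain ⟨p, rfl⟩ := Ideal.Quotient.mk_surjective a
    rw [Derivation.smul_apply, logDerDescendFun_mk, logDerDescendFun_mk, Submodule.coe_smul,
      Derivation.smul_apply, smul_eq_mul, map_mul]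
    rfl

theorem logDerDescend_mk (f : MvPolynomial (Fin n) k) (δ : logDer f) (p : MvPolynomial (Fin n) k) :
    logDerDescend f δ (Ideal.Quotient.mk _ p) = Ideal.Quotient.mk _ (δ.1 p) :=
  logDerDescendFun_mk f δ p

/-- The module of logarithmic derivations, in the coordinates `δ ↦ (δ(x₁), …, δ(xₙ))`, is the
deformation of `Der_k(k[x]/(f))` along `k[x] → k[x]/(f)`. -/
def logDerEquiv (f : MvPolynomial (Fin n) k) :
    logDer f ≃ₗ[MvPolynomial (Fin n) k] deformation (MvPolynomial (Fin n) k) (derEmbedding f) :=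
  LinearEquiv.ofBijective
    { toFun := fun δ => ⟨fun i => δ.1 (X i), (mem_deformation _ _).2
        ⟨logDerDescend f δ, fun i => logDerDescend_mk f δ (X i)⟩⟩
      map_add' := fun _ _ => rfl
      map_smul' := fun _ _ => rfl }
    (by
      constructor
      · intro δ δ' h
        exact Subtype.ext (MvPolynomial.derivation_ext fun i => congrFun (congrArg Subtype.val h) i)
      · rintro ⟨v, hv⟩
        obtain ⟨x, hx⟩ := (mem_deformation _ _).1 hv
        have key : ∀ p, x (Ideal.Quotient.mk _ p) =
            Ideal.Quotient.mk (Ideal.span {f}) (mkDerivation k v p) := by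
          have : x.compAlgebraMap (MvPolynomial (Fin n) k) =
              (Algebra.linearMap (MvPolynomial (Fin n) k) (HypersurfaceRing f)).compDer
                (mkDerivation k v) := by
            refine MvPolynomial.derivation_ext fun i => ?_
            refine (hx i).trans ?_
            rw [← mkDerivation_X k v i]
            rfl
          exact fun p => Derivation.congr_fun this p
        refine ⟨⟨mkDerivation k v, fun a ha => ?_⟩, ?_⟩
        · rw [← Ideal.Quotient.eq_zero_iff_mem, ← key, Ideal.Quotient.eq_zero_iff_mem.2 ha,
            map_zero]
        · exact Subtype.ext (funext fun i => mkDerivation_X k v i))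

/-- The matrix whose `j`-th column consists of the coordinates `eⱼ(x₁), …, eⱼ(xₙ)` of the `j`-th
basis element. -/
def basisMatrix {f : MvPolynomial (Fin n) k}
    (e : Module.Basis (Fin n) (MvPolynomial (Fin n) k) (logDer f)) :
    Matrix (Fin n) (Fin n) (MvPolynomial (Fin n) k) :=
  Matrix.of fun i j => (e j).1 (X i)

/-- The `(n+1) × n` matrix over `k[x][U₁, …, Uₙ]` with first row `U₁, …, Uₙ`, stacked over the
matrix of the basis. -/
def stackedMatrix {f : MvPolynomial (Fin n) k}
    (e : Module.Basis (Fin n) (MvPolynomial (Fin n) k) (logDer f)) :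
    Matrix (Fin (n + 1)) (Fin n) (MvPolynomial (Fin n) (MvPolynomial (Fin n) k)) :=
  Matrix.of (Fin.cons (fun j => X j) (fun i j => C (basisMatrix e i j)))

/-- The `R`-algebra map `R[U₁, …, Uₙ] → Rees_R(𝐄)`, `Uⱼ ↦ eⱼ`. -/
def reesPresentation {f : MvPolynomial (Fin n) k}
    (e : Module.Basis (Fin n) (MvPolynomial (Fin n) k) (logDer f)) :
    MvPolynomial (Fin n) (MvPolynomial (Fin n) k) →ₐ[MvPolynomial (Fin n) k]
      ReesAlgebra (MvPolynomial (Fin n) k)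
        (deformation (MvPolynomial (Fin n) k) (derEmbedding f)) :=
  aeval fun j => Ideal.Quotient.mk _ (SymmetricAlgebra.ι _ _ (logDerEquiv f (e j)))

/-- The map from `R[U₁, …, Uₙ]` to the embedded Aluffi algebra: `Uⱼ ↦ eⱼ` followed by the
canonical map from the Rees algebra of `𝐄`. -/
def aluffiPresentation {f : MvPolynomial (Fin n) k}
    (e : Module.Basis (Fin n) (MvPolynomial (Fin n) k) (logDer f)) :
    MvPolynomial (Fin n) (MvPolynomial (Fin n) k) →+*
      EmbeddedAluffi (MvPolynomial (Fin n) k) (derEmbedding f) :=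
  (reesToAluffi _ _).comp (reesPresentation e).toRingHom

/-- The weighted grading of `k[x][U] = k[U, x]` in which each `xᵢ` has weight `1` and `Uⱼ` has
weight `w j`: an ideal is homogeneous for it if it contains the weighted homogeneous components
of all its elements. -/
def IsQuasiHomogeneousIdeal (w : Fin n → ℕ)
    (I : Ideal (MvPolynomial (Fin n) (MvPolynomial (Fin n) k))) : Prop :=
  ∀ p ∈ I, ∀ N : ℕ,
    sumAlgEquiv k (Fin n) (Fin n)
      (weightedHomogeneousComponent (Sum.elim w fun _ : Fin n => 1) N
        ((sumAlgEquiv k (Fin n) (Fin n)).symm p)) ∈ I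

end Hypersurface

end

/-! Write 𝓔 for the matrix of a basis of the logarithmic derivations. The engine is one half of
Saito's criterion, `associated_det_basisMatrix`: det 𝓔 equals f up to a unit, so it is squarefree.
By Cramer's rule, ∑ cⱼ eⱼ induces zero on A iff f divides 𝓔c, that is, iff c lies in the image of
adj 𝓔. Hence E is the cokernel of adj 𝓔, and S_A(E) = R[U]/𝔄, where 𝔄 is generated by det 𝓔 and the
entries of U·adj 𝓔 (`minorsIdeal_le_ker_symPresentation`, `ker_symPresentation_le`). Up to sign
these are the maximal minors of the stacked matrix.

Since det 𝓔 is squarefree, none of its prime factors p divides all cofactors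
(`exists_not_dvd_adjugate`). So 𝔄 is contained in no ideal (p), which gives height and grade at
least 2, and also Hilbert–Burch exactness by a direct divisibility argument
(`mem_range_stackRow_iff`). The upper bound on the height holds because the adjugate has rank one
modulo p (`height_minorsIdeal_le_two`). The resolution is minimal in the sense needed because the
stacked matrix acquires a kernel at the origin U = 0, x = 0.

For (a), 𝐄 is free, so S_R(𝐄) has no torsion and the R-embedded Aluffi algebra is S_A(E). For the
inverse limit, let D be a domain mapping to R over A. Torsion of S_D(𝐄_D) dies in D[X], hence in
R[X]; as S_R(𝐄) → R[X] is injective (`symCoord_injective`), it already dies in S_R(𝐄) and thus in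
S_A(E). Every cover is dominated, jointly with R, by such a polynomial ring D, so the component at R
determines all others. -/

noncomputable section

/-! ### Cramer's rule and Hilbert–Burch for a square matrix with one extra row -/

section HilbertBurch

open scoped Matrix

variable {S : Type*} [CommRing S] {n : ℕ}

theorem Matrix.det_updateRow_eq_vecMul_adjugate (A : Matrix (Fin n) (Fin n) S) (i : Fin n)
    (u : Fin n → S) : (A.updateRow i u).det = (u ᵥ* A.adjugate) i := by
  rw [← Matrix.cramer_transpose_apply, Matrix.cramer_eq_adjugate_mulVec, ← Matrix.adjugate_transpose,
    Matrix.mulVec_transpose]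

/-- The cofactors in column `i` of the adjugate do not involve row `i` of the matrix. -/
theorem Matrix.adjugate_updateRow_apply (A : Matrix (Fin n) (Fin n) S) (i l : Fin n)
    (u : Fin n → S) : (A.updateRow i u).adjugate l i = A.adjugate l i := by
  rw [Matrix.adjugate_apply, Matrix.adjugate_apply, Matrix.updateRow_idem]

/-- For `b = adj(A) v`, the vector `(u adj(A))ᵢ b` is congruent modulo `det A` to the multiple of
the `i`-th column of the adjugate by `u ⬝ b`. -/
theorem Matrix.exists_vecMul_adjugate_mul_eq (A : Matrix (Fin n) (Fin n) S) (u v : Fin n → S)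
    (i : Fin n) : ∃ c : Fin n → S, ∀ l, (u ᵥ* A.adjugate) i * (A.adjugate *ᵥ v) l =
      A.det * c l + (u ⬝ᵥ (A.adjugate *ᵥ v)) * A.adjugate l i := by
  set b := A.adjugate *ᵥ v with hb
  set N := A.updateRow i u with hN
  -- Off row `i`, `N` agrees with `A`, and `A b = det A • v`; row `i` contributes `u ⬝ᵥ b`. Applying
  -- `adj N` turns the left side into `det N • b`, and `det N` is the `i`-th entry of `u ᵥ* adj A`.
  have hNb : N *ᵥ b = A.det • Function.update v i 0 + Pi.single i (u ⬝ᵥ b) := by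
    have hAb : A *ᵥ b = A.det • v := by
      rw [hb, Matrix.mulVec_mulVec, Matrix.mul_adjugate, Matrix.smul_mulVec, Matrix.one_mulVec]
    ext r
    by_cases hr : r = i
    · subst hr
      simp [hN, Matrix.mulVec]
    · have := congrFun hAb r
      simp only [Matrix.mulVec] at this
      simp [hN, Matrix.mulVec, hr, this]
  refine ⟨N.adjugate *ᵥ Function.update v i 0, fun l => ?_⟩
  have h := congrFun (congrArg (fun w => N.adjugate *ᵥ w) hNb) l
  simp only [Matrix.mulVec_mulVec, Matrix.adjugate_mul, Matrix.smul_mulVec, Matrix.one_mulVec,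
    Matrix.mulVec_add, Matrix.mulVec_smul, Pi.add_apply, Pi.smul_apply, smul_eq_mul,
    Matrix.mulVec_single] at h
  rw [← Matrix.det_updateRow_eq_vecMul_adjugate, h, ← A.adjugate_updateRow_apply i l u]
  simp [hN, mul_comm]

/-- The matrix obtained by putting the row `u` on top of the square matrix `A`. -/
def stackRow (u : Fin n → S) (A : Matrix (Fin n) (Fin n) S) : Matrix (Fin (n + 1)) (Fin n) S :=
  Matrix.of (Fin.cons u A)

/-- The signed maximal minors of `stackRow u A`. -/
def stackMinors (u : Fin n → S) (A : Matrix (Fin n) (Fin n) S) : Fin (n + 1) → S :=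
  Fin.cons A.det (-(u ᵥ* A.adjugate))

theorem stackRow_mulVec_zero (u : Fin n → S) (A : Matrix (Fin n) (Fin n) S) (c : Fin n → S) :
    (stackRow u A *ᵥ c) 0 = u ⬝ᵥ c := rfl

theorem stackRow_mulVec_succ (u : Fin n → S) (A : Matrix (Fin n) (Fin n) S) (c : Fin n → S)
    (i : Fin n) : (stackRow u A *ᵥ c) i.succ = (A *ᵥ c) i := rfl

theorem stackMinors_dotProduct (u : Fin n → S) (A : Matrix (Fin n) (Fin n) S)
    (a : Fin (n + 1) → S) : ∑ i, a i * stackMinors u A i =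
      A.det * a 0 - u ⬝ᵥ (A.adjugate *ᵥ fun i => a i.succ) := by
  rw [Fin.sum_univ_succ, Matrix.dotProduct_mulVec]
  simp only [stackMinors, Fin.cons_zero, Fin.cons_succ, Pi.neg_apply, mul_neg,
    Finset.sum_neg_distrib, dotProduct]
  rw [mul_comm, sub_eq_add_neg]
  simp only [mul_comm]

theorem stackRow_mulVecLin_injective [IsDomain S] (u : Fin n → S) {A : Matrix (Fin n) (Fin n) S}
    (h : A.det ≠ 0) : Function.Injective (stackRow u A).mulVecLin := by
  refine (injective_iff_map_eq_zero _).2 fun c hc => ?_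
  refine Matrix.eq_zero_of_mulVec_eq_zero h (funext fun i => ?_)
  exact congrFun hc i.succ

/-- Hilbert–Burch without resolutions. Hypothesis `hu` replaces the condition that the minors have
grade two. A relation says `det A * a 0 = u ⬝ᵥ adj A v`, so `det A` divides every product of an
entry of `u ᵥ* adj A` with an entry of `adj A v`; `hu` then gives `adj A v = det A • c`, and
cancelling `det A` shows that `c` is the required preimage. -/
theorem mem_range_stackRow_iff [IsDomain S] (u : Fin n → S) {A : Matrix (Fin n) (Fin n) S}
    (hA : A.det ≠ 0)
    (hu : ∀ b, (∀ i, A.det ∣ (u ᵥ* A.adjugate) i * b) → A.det ∣ b) (a : Fin (n + 1) → S) :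
    (∃ c, stackRow u A *ᵥ c = a) ↔ ∑ i, a i * stackMinors u A i = 0 := by
  rw [stackMinors_dotProduct]
  constructor
  · rintro ⟨c, rfl⟩
    have : (fun i : Fin n => (stackRow u A *ᵥ c) i.succ) = A *ᵥ c := rfl
    rw [this, stackRow_mulVec_zero, Matrix.mulVec_mulVec, Matrix.adjugate_mul, Matrix.smul_mulVec,
      Matrix.one_mulVec, dotProduct_smul, smul_eq_mul, sub_self]
  · intro h
    set v : Fin n → S := fun i => a i.succ with hv
    have hdvd : ∀ l, A.det ∣ (A.adjugate *ᵥ v) l := fun l => hu _ fun i => by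
      obtain ⟨c, hc⟩ := A.exists_vecMul_adjugate_mul_eq u v i
      rw [hc l, ← sub_eq_zero.1 h, mul_assoc, ← mul_add]
      exact dvd_mul_right _ _
    choose c hc using hdvd
    have hc' : A.adjugate *ᵥ v = A.det • c := funext hc
    refine ⟨c, funext fun i => ?_⟩
    refine Fin.cases ?_ (fun i => ?_) i
    · rw [stackRow_mulVec_zero]
      rw [hc', dotProduct_smul, smul_eq_mul, ← mul_sub] at h
      exact (sub_eq_zero.1 ((mul_eq_zero.1 h).resolve_left hA)).symm
    · rw [stackRow_mulVec_succ]
      have h2 := congrArg (A *ᵥ ·) hc'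
      simp only [Matrix.mulVec_mulVec, Matrix.mul_adjugate, Matrix.smul_mulVec, Matrix.one_mulVec,
        Matrix.mulVec_smul] at h2
      exact (mul_left_cancel₀ hA (congrFun h2 i)).symm

/-- If `det A` is squarefree, then a prime factor of `det A` does not divide all entries of the
adjugate. -/
theorem exists_not_dvd_adjugate [IsDomain S] {A : Matrix (Fin n) (Fin n) S}
    (hA : Squarefree A.det) {p : S} (hp : Prime p) (hpA : p ∣ A.det) :
    ∃ l i, ¬ p ∣ A.adjugate l i := by
  by_contra! h
  have hn : n ≠ 0 := by
    rintro rfl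
    exact hp.not_isUnit (isUnit_of_dvd_one (by simpa using hpA))
  obtain ⟨m, rfl⟩ := Nat.exists_eq_succ_of_ne_zero hn
  choose B hB using h
  have hadj : A.adjugate = p • Matrix.of B := by
    ext l i
    exact hB l i
  obtain ⟨e, he⟩ := hpA
  have hpe : ¬ p ∣ e := by
    rintro ⟨e', rfl⟩
    exact hp.not_isUnit (hA p ⟨e', by rw [he, mul_assoc]⟩)
  -- In size m + 1, det (adj A) = (det A)^m. The left side would be divisible by p^(m+1), but p
  -- divides det A = p * e exactly once, so only p^m divides the right side.
  have hdet := A.det_adjugate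
  rw [hadj, Matrix.det_smul, Fintype.card_fin, he, Nat.succ_sub_one, mul_pow,
    show p ^ m.succ = p ^ m * p from pow_succ p m, mul_assoc] at hdet
  have := mul_left_cancel₀ (pow_ne_zero m hp.ne_zero) hdet
  exact hpe (hp.dvd_of_dvd_pow ⟨_, this.symm⟩)

theorem Squarefree.dvd_of_forall_prime_dvd [IsDomain S] [UniqueFactorizationMonoid S] {d b : S}
    (hd : Squarefree d) (h : ∀ p, Prime p → p ∣ d → p ∣ b) : d ∣ b := by
  induction d using UniqueFactorizationMonoid.induction_on_coprime with
  | h0 => exact absurd hd not_squarefree_zero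
  | h1 hx => exact hx.dvd
  | hpr i hp =>
    rename_i p
    rcases Nat.lt_trichotomy i 1 with hi | rfl | hi
    · obtain rfl : i = 0 := by omega
      simp
    · rw [pow_one]
      exact h p hp (by simp)
    · exact absurd (hd p (by rw [← sq]; exact pow_dvd_pow p hi)) hp.not_isUnit
  | hcp hxy hx hy =>
    refine hxy.mul_dvd ?_ ?_
    · exact hx hd.of_mul_left fun p hp hpx => h p hp (hpx.mul_right _)
    · exact hy hd.of_mul_right fun p hp hpx => h p hp (hpx.mul_left _)

end HilbertBurch

/-! ### Logarithmic derivations and Saito's criterion -/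

section FreeDivisor

open scoped Matrix

variable {k : Type u} [Field k] {n : ℕ}

theorem MvPolynomial.totalDegree_pderiv_lt {σ R : Type*} [CommSemiring R] (i : σ)
    {p : MvPolynomial σ R} (h : pderiv i p ≠ 0) : (pderiv i p).totalDegree < p.totalDegree := by
  obtain ⟨m, hm, hm'⟩ := Finset.exists_mem_eq_sup _ (support_nonempty.2 h)
    fun s : σ →₀ ℕ => s.sum fun _ e => e
  have hc : coeff (m + Finsupp.single i 1) p ≠ 0 := fun h0 => by
    rw [mem_support_iff, coeff_pderiv, h0, zero_mul] at hm
    exact hm rfl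
  have hle := le_totalDegree (mem_support_iff.2 hc)
  rw [Finsupp.sum_add_index' (fun _ => rfl) (fun _ _ _ => rfl),
    Finsupp.sum_single_index rfl] at hle
  rw [totalDegree, hm']
  omega

theorem MvPolynomial.eq_C_of_pderiv_eq_zero [CharZero k] {σ : Type*} {p : MvPolynomial σ k}
    (h : ∀ i, pderiv i p = 0) : p = C (coeff 0 p) := by
  classical
  ext m
  rw [coeff_C]
  split_ifs with hm
  · rw [hm]
  · obtain ⟨i, hi⟩ : ∃ i, m i ≠ 0 := by
      by_contra! h0
      exact hm (Finsupp.ext fun i => (h0 i).symm)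
    have hle : Finsupp.single i 1 ≤ m := by
      rw [Finsupp.single_le_iff]; omega
    have hcoeff := coeff_pderiv (i := i) p (m - Finsupp.single i 1)
    rw [h i, coeff_zero, tsub_add_cancel_of_le hle] at hcoeff
    exact (mul_eq_zero.1 hcoeff.symm).resolve_right (Nat.cast_add_one_ne_zero _)

/-- A nonzero derivative has smaller degree than `p`, so divisibility forces all derivatives to
vanish. In characteristic zero `p` is then constant, which a prime cannot be. -/
theorem Prime.exists_not_dvd_pderiv [CharZero k] {σ : Type*} {p : MvPolynomial σ k}
    (hp : Prime p) : ∃ i, ¬ p ∣ pderiv i p := by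
  by_contra! h
  have h0 : ∀ i, pderiv i p = 0 := by
    intro i
    by_contra hi
    obtain ⟨q, hq⟩ := h i
    have hlt := totalDegree_pderiv_lt i hi
    rw [hq, totalDegree_mul_of_isDomain hp.ne_zero (fun hq0 => hi (by rw [hq, hq0, mul_zero]))]
      at hlt
    omega
  have hC := eq_C_of_pderiv_eq_zero h0
  refine hp.not_isUnit ?_
  rw [hC]
  refine IsUnit.map C (IsUnit.mk0 _ fun h0 => hp.ne_zero ?_)
  rw [hC, h0, map_zero]

/-- With f = p g, modulo p the derivative is g ∂p, and p divides neither g nor some ∂ᵢp. -/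
theorem Squarefree.exists_not_dvd_pderiv [CharZero k] {σ : Type*} {f p : MvPolynomial σ k}
    (hf : Squarefree f) (hp : Prime p) (hpf : p ∣ f) : ∃ i, ¬ p ∣ pderiv i f := by
  obtain ⟨i, hi⟩ := hp.exists_not_dvd_pderiv
  obtain ⟨g, rfl⟩ := hpf
  refine ⟨i, fun h => ?_⟩
  rw [pderiv_mul, dvd_add_left (dvd_mul_right _ _)] at h
  rcases hp.dvd_or_dvd h with h | ⟨g', rfl⟩
  · exact hi h
  · exact hp.not_isUnit (hf p ⟨g', by rw [mul_assoc]⟩)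

theorem Derivation.sum_apply {R A M ι : Type*} [CommSemiring R] [CommSemiring A]
    [AddCommMonoid M] [Algebra R A] [Module A M] [Module R M] (s : Finset ι)
    (δ : ι → Derivation R A M) (a : A) : (∑ i ∈ s, δ i) a = ∑ i ∈ s, δ i a := by
  have := congrFun (map_sum (Derivation.coeFnAddMonoidHom (R := R) (A := A) (M := M)) δ s) a
  rwa [Finset.sum_apply] at this

theorem MvPolynomial.derivation_apply_eq_sum {σ R : Type*} [Fintype σ] [CommSemiring R]
    (δ : Derivation R (MvPolynomial σ R) (MvPolynomial σ R)) (p : MvPolynomial σ R) :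
    δ p = ∑ i, δ (X i) * pderiv i p := by
  classical
  have : δ = ∑ i, δ (X i) • pderiv i := derivation_ext fun j => by
    rw [Derivation.sum_apply, Finset.sum_eq_single j]
    · simp
    · intro i _ hij
      rw [Derivation.smul_apply, pderiv_X_of_ne hij.symm, smul_zero]
    · simp
  conv_lhs => rw [this]
  rw [Derivation.sum_apply]
  rfl

theorem mem_logDer_iff {f : MvPolynomial (Fin n) k}
    {δ : Derivation k (MvPolynomial (Fin n) k) (MvPolynomial (Fin n) k)} :
    δ ∈ logDer f ↔ f ∣ δ f := by
  constructor
  · exact fun h => Ideal.mem_span_singleton.1 (h f (Ideal.mem_span_singleton_self f))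
  · intro h a ha
    obtain ⟨b, rfl⟩ := Ideal.mem_span_singleton.1 ha
    rw [Ideal.mem_span_singleton, Derivation.leibniz, smul_eq_mul, smul_eq_mul]
    exact dvd_add (dvd_mul_right _ _) (h.mul_left _)

/-- The rank is squeezed to n: the coordinates embed the module into Rⁿ, and multiplication by f
embeds Rⁿ ≃ Der(R) back into it. -/
theorem nonempty_basis_logDer {f : MvPolynomial (Fin n) k} (hf : f ≠ 0)
    (hfree : Module.Free (MvPolynomial (Fin n) k) (logDer f)) :
    Nonempty (Module.Basis (Fin n) (MvPolynomial (Fin n) k) (logDer f)) := by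
  let ev : logDer f →ₗ[MvPolynomial (Fin n) k] (Fin n → MvPolynomial (Fin n) k) :=
    { toFun := fun δ i => δ.1 (X i)
      map_add' := fun _ _ => rfl
      map_smul' := fun _ _ => rfl }
  have hev : Function.Injective ev := fun δ δ' h =>
    Subtype.ext (derivation_ext fun i => congrFun h i)
  let mul : (Fin n → MvPolynomial (Fin n) k) →ₗ[MvPolynomial (Fin n) k] logDer f :=
    { toFun := fun v => ⟨f • mkDerivation k v, mem_logDer_iff.2 (dvd_mul_right _ _)⟩
      map_add' := fun v w => Subtype.ext <| derivation_ext fun i => by simp [mkDerivation_X, mul_add]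
      map_smul' := fun r v => Subtype.ext <| derivation_ext fun i => by
        simp [mkDerivation_X, mul_left_comm] }
  have hmul : Function.Injective mul := fun v w h => funext fun i => by
    have := Derivation.congr_fun (congrArg Subtype.val h) (X i)
    simp only [mul, LinearMap.coe_mk, AddHom.coe_mk, Derivation.smul_apply, mkDerivation_X,
      smul_eq_mul] at this
    exact mul_left_cancel₀ hf this
  have : Module.Finite (MvPolynomial (Fin n) k) (logDer f) := Module.Finite.of_injective ev hev
  refine ⟨Module.finBasisOfFinrankEq _ _ (le_antisymm ?_ ?_)⟩
  · simpa using LinearMap.finrank_le_finrank_of_injective hev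
  · simpa using LinearMap.finrank_le_finrank_of_injective hmul

variable {f : MvPolynomial (Fin n) k}
  (e : Module.Basis (Fin n) (MvPolynomial (Fin n) k) (logDer f))

theorem basisMatrix_mulVec (c : Fin n → MvPolynomial (Fin n) k) (i : Fin n) :
    (basisMatrix e *ᵥ c) i = (∑ j, c j • e j).1 (X i) := by
  rw [AddSubmonoidClass.coe_finsetSum, Derivation.sum_apply]
  simp only [Matrix.mulVec, dotProduct, basisMatrix, Matrix.of_apply]
  exact Finset.sum_congr rfl fun j _ => mul_comm _ _

theorem exists_basisMatrix_mulVec_eq {v : Fin n → MvPolynomial (Fin n) k}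
    (hv : f ∣ ∑ i, v i * pderiv i f) : ∃ c, basisMatrix e *ᵥ c = v := by
  have hδ : mkDerivation k v ∈ logDer f := by
    rw [mem_logDer_iff, derivation_apply_eq_sum]
    simpa only [mkDerivation_X] using hv
  refine ⟨e.repr ⟨_, hδ⟩, funext fun i => ?_⟩
  rw [basisMatrix_mulVec, e.sum_repr, mkDerivation_X]

/-- The columns of `W` are logarithmic, hence combinations of the basis, so `W` factors through the
basis matrix. Suitable choices of `W` bound the determinant from above. -/
theorem det_basisMatrix_dvd {W : Matrix (Fin n) (Fin n) (MvPolynomial (Fin n) k)}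
    (hW : ∀ j, f ∣ ∑ i, W i j * pderiv i f) : (basisMatrix e).det ∣ W.det := by
  choose B hB using fun j => exists_basisMatrix_mulVec_eq e (hW j)
  have : W = basisMatrix e * (Matrix.of B)ᵀ := by
    refine Matrix.ext fun i j => ?_
    exact (congrFun (hB j) i).symm
  rw [this, Matrix.det_mul]
  exact dvd_mul_right _ _

/-- Modulo a prime factor p of f, the gradient of f is a left kernel vector of the basis matrix,
because f divides every eⱼ(f). It is nonzero modulo p since f is squarefree, so the determinant
vanishes in the domain R/(p). -/
theorem dvd_det_basisMatrix [CharZero k] (hf : Squarefree f) : f ∣ (basisMatrix e).det := by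
  refine hf.dvd_of_forall_prime_dvd fun p hp hpf => ?_
  have hI : (Ideal.span {p}).IsPrime := (Ideal.span_singleton_prime hp.ne_zero).2 hp
  set φ := Ideal.Quotient.mk (Ideal.span {p}) with hφ
  have hφ0 : ∀ {x}, φ x = 0 ↔ p ∣ x := fun {x} => by
    rw [hφ, Ideal.Quotient.eq_zero_iff_mem, Ideal.mem_span_singleton]
  obtain ⟨i, hi⟩ := hf.exists_not_dvd_pderiv hp hpf
  rw [← hφ0, RingHom.map_det, ← Matrix.exists_vecMul_eq_zero_iff]
  refine ⟨fun i => φ (pderiv i f), fun h => hi (hφ0.1 (congrFun h i)), funext fun j => ?_⟩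
  have hj : p ∣ (e j).1 f := hpf.trans (mem_logDer_iff.1 (e j).2)
  rw [derivation_apply_eq_sum, ← hφ0, map_sum] at hj
  rw [Pi.zero_apply, ← hj]
  simp only [Matrix.vecMul, dotProduct]
  exact Finset.sum_congr rfl fun i _ => by
    rw [map_mul, mul_comm]; rfl

theorem det_basisMatrix_dvd_pow : (basisMatrix e).det ∣ f ^ n := by
  -- The test fields are f ∂ⱼ.
  have := det_basisMatrix_dvd e (W := Matrix.scalar (Fin n) f) fun j => by
    refine Finset.dvd_sum fun i _ => ?_
    rcases eq_or_ne i j with rfl | h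
    · simp
    · simp [h]
  simpa using this

/-- The test fields are f ∂ᵢ and, for j ≠ i, the Hamiltonian fields (∂ᵢf) ∂ⱼ − (∂ⱼf) ∂ᵢ, which kill
f. Their matrix is ∂ᵢf times the identity with row `i` replaced. -/
theorem det_basisMatrix_dvd_pderiv_pow_mul (i : Fin n) :
    (basisMatrix e).det ∣ pderiv i f ^ (n - 1) * f := by
  set g := pderiv i f with hg
  set r : Fin n → MvPolynomial (Fin n) k :=
    Function.update (fun j => -pderiv j f) i f with hr
  have hdet : ((g • (1 : Matrix (Fin n) (Fin n) (MvPolynomial (Fin n) k))).updateRow i r).det =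
      g ^ (n - 1) * f := by
    rw [← Matrix.cramer_transpose_apply, Matrix.transpose_smul, Matrix.transpose_one,
      Matrix.cramer_smul, Matrix.cramer_one]
    simp [hr]
  rw [← hdet]
  refine det_basisMatrix_dvd e fun j => ?_
  have hsum : ∀ l, (g • (1 : Matrix (Fin n) (Fin n) (MvPolynomial (Fin n) k))).updateRow i r l j =
      (if l = i then r j else 0) + if l = j then (if j = i then 0 else g) else 0 := by
    intro l
    rw [Matrix.updateRow_apply, Matrix.smul_apply, Matrix.one_apply]
    split_ifs <;> simp_all
  simp only [hsum, add_mul, Finset.sum_add_distrib, ite_mul, zero_mul, Finset.sum_ite_eq',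
    Finset.mem_univ, if_true]
  by_cases hj : j = i
  · subst hj
    simp [hr]
  · simp [hr, hj, ← hg, mul_comm]

/-- Let det 𝓔 = f g and let q be a prime factor of g. Then q divides f because det 𝓔 divides fⁿ, and
q divides every (∂ᵢf)^(n−1) after cancelling f. This contradicts squarefreeness of f. -/
theorem associated_det_basisMatrix [CharZero k] (hf : Squarefree f) :
    Associated f (basisMatrix e).det := by
  obtain ⟨g, hg⟩ := dvd_det_basisMatrix e hf
  have hf0 := hf.ne_zero
  suffices IsUnit g from ⟨this.unit, by rw [hg]; rfl⟩
  by_contra hgu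
  have hg0 : g ≠ 0 := by
    rintro rfl
    rw [mul_zero] at hg
    have := det_basisMatrix_dvd_pow e
    rw [hg, zero_dvd_iff] at this
    exact pow_ne_zero _ hf0 this
  obtain ⟨q, hq, hqg⟩ := WfDvdMonoid.exists_irreducible_factor hgu hg0
  have hq := hq.prime
  have hqf : q ∣ f := hq.dvd_of_dvd_pow
    ((hqg.trans (Dvd.intro_left f hg.symm)).trans (det_basisMatrix_dvd_pow e))
  obtain ⟨i, hi⟩ := hf.exists_not_dvd_pderiv hq hqf
  have h := det_basisMatrix_dvd_pderiv_pow_mul e i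
  rw [hg, mul_comm] at h
  exact hi (hq.dvd_of_dvd_pow (hqg.trans ((mul_dvd_mul_iff_right hf0).1 h)))

theorem det_basisMatrix_ne_zero [CharZero k] (hf : Squarefree f) : (basisMatrix e).det ≠ 0 :=
  (associated_det_basisMatrix e hf).ne_zero_iff.1 hf.ne_zero

theorem squarefree_det_basisMatrix [CharZero k] (hf : Squarefree f) :
    Squarefree (basisMatrix e).det :=
  hf.squarefree_of_dvd (associated_det_basisMatrix e hf).symm.dvd

end FreeDivisor

/-! ### Torsion of symmetric algebras, embedded and absolute Aluffi algebras -/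

section Aluffi

open scoped Matrix

theorem SymmetricAlgebra.ringHom_ext {R M B : Type*} [CommRing R] [AddCommGroup M] [Module R M]
    [Semiring B] {g h : SymmetricAlgebra R M →+* B}
    (h₁ : ∀ r, g (algebraMap R _ r) = h (algebraMap R _ r))
    (h₂ : ∀ m, g (ι R M m) = h (ι R M m)) : g = h := by
  refine RingHom.ext fun x => ?_
  induction x using SymmetricAlgebra.induction with
  | algebraMap r => exact h₁ r
  | ι m => exact h₂ m
  | mul a b ha hb => rw [map_mul, map_mul, ha, hb]
  | add a b ha hb => rw [map_add, map_add, ha, hb]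

/-- The symmetric algebra of a free module over a domain is again a domain, and it contains `R`. -/
theorem symTorsion_eq_bot (R M : Type*) [CommRing R] [IsDomain R] [AddCommGroup M] [Module R M]
    [Module.Free R M] : symTorsion R M = ⊥ := by
  refine eq_bot_iff.2 ?_
  rintro z ⟨a, ha, hz⟩
  rw [Algebra.smul_def] at hz
  refine (mul_eq_zero.1 hz).resolve_left fun h => nonZeroDivisors.ne_zero ha ?_
  exact (SymmetricAlgebra.algebraMap_eq_zero_iff M a).1 h

section General

variable (R : Type*) {A E ι : Type*} [CommRing R] [CommRing A] [Algebra R A]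
  [AddCommGroup E] [Module A E] (φ : FreeEmbedding A E ι)

theorem deformationMap_eq_iff {v : deformation R φ} {x : E} :
    deformationMap R φ v = x ↔ ∀ i, φ.toLin x i = algebraMap R A (v.1 i) := by
  refine ⟨fun h i => by rw [← h, deformationMap_spec], fun h => φ.injective (funext fun i => ?_)⟩
  rw [deformationMap_spec, h]

theorem deformationMap_surjective (h : Function.Surjective (algebraMap R A)) :
    Function.Surjective (deformationMap R φ) := fun x => by
  choose v hv using fun i => h (φ.toLin x i)
  exact ⟨⟨v, (mem_deformation R φ).2 ⟨x, fun i => (hv i).symm⟩⟩,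
    (deformationMap_eq_iff R φ).2 fun i => (hv i).symm⟩

theorem symDeformationMap_surjective (h : Function.Surjective (algebraMap R A)) :
    Function.Surjective (symDeformationMap R φ) := fun x => by
  induction x using SymmetricAlgebra.induction with
  | algebraMap a =>
    obtain ⟨r, rfl⟩ := h a
    exact ⟨_, symDeformationMap_algebraMap R φ r⟩
  | ι m =>
    obtain ⟨v, rfl⟩ := deformationMap_surjective R φ h m
    exact ⟨_, symDeformationMap_ι R φ v⟩
  | mul a b ha hb =>
    obtain ⟨a, rfl⟩ := ha
    obtain ⟨b, rfl⟩ := hb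
    exact ⟨a * b, map_mul _ _ _⟩
  | add a b ha hb =>
    obtain ⟨a, rfl⟩ := ha
    obtain ⟨b, rfl⟩ := hb
    exact ⟨a + b, map_add _ _ _⟩

theorem symToAluffi_surjective : Function.Surjective (symToAluffi R φ) :=
  Algebra.TensorProduct.includeLeft_surjective (R := SymmetricAlgebra R (deformation R φ))
    (SymmetricAlgebra R (deformation R φ)) (SymmetricAlgebra A E) Ideal.Quotient.mk_surjective

theorem reesToAluffi_mk (z : SymmetricAlgebra R (deformation R φ)) :
    reesToAluffi R φ (Ideal.Quotient.mk _ z) = symToAluffi R φ (symDeformationMap R φ z) :=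
  (Algebra.TensorProduct.algebraMap_apply' z).symm.trans
    (Algebra.TensorProduct.algebraMap_apply z)

theorem reesToAluffi_surjective (h : Function.Surjective (algebraMap R A)) :
    Function.Surjective (reesToAluffi R φ) := fun x => by
  obtain ⟨s, rfl⟩ := symToAluffi_surjective R φ x
  obtain ⟨z, rfl⟩ := symDeformationMap_surjective R φ h s
  exact ⟨_, reesToAluffi_mk R φ z⟩

/-- If torsion dies in S_A(E), the structure map factors through the Rees algebra; together with the
identity of S_A(E) this gives a retraction of s ↦ s ⊗ 1. -/
theorem symToAluffi_injective
    (h : ∀ z ∈ symTorsion R (deformation R φ), symDeformationMap R φ z = 0) :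
    Function.Injective (symToAluffi R φ) := by
  let ρ : ReesAlgebra R (deformation R φ) →ₐ[SymmetricAlgebra R (deformation R φ)]
      SymmetricAlgebra A E :=
    Ideal.Quotient.liftₐ _ (Algebra.ofId _ _) h
  let r : SymmetricAlgebra A E ⊗[SymmetricAlgebra R (deformation R φ)]
      ReesAlgebra R (deformation R φ) →ₐ[SymmetricAlgebra R (deformation R φ)]
      SymmetricAlgebra A E :=
    Algebra.TensorProduct.lift (AlgHom.id _ _) ρ fun _ _ => Commute.all _ _
  refine Function.LeftInverse.injective (g := r) fun s => ?_
  exact (Algebra.TensorProduct.lift_tmul _ _ _ s 1).trans (by rw [map_one, mul_one]; rfl)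

theorem symToAluffi_bijective [IsDomain R] [Module.Free R (deformation R φ)] :
    Function.Bijective (symToAluffi R φ) := by
  refine ⟨symToAluffi_injective R φ fun z hz => ?_, symToAluffi_surjective R φ⟩
  rw [symTorsion_eq_bot, Ideal.mem_bot] at hz
  rw [hz, map_zero]

/-- The map `S_R(𝐄) → R[X]` induced by the inclusion of the deformation into `R^ι`. -/
def symCoord [Fintype ι] : SymmetricAlgebra R (deformation R φ) →ₐ[R] MvPolynomial ι R :=
  SymmetricAlgebra.lift
    ((Fintype.linearCombination R (X : ι → MvPolynomial ι R)).comp (deformation R φ).subtype)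

theorem symCoord_ι [Fintype ι] (v : deformation R φ) :
    symCoord R φ (SymmetricAlgebra.ι R _ v) = ∑ i, v.1 i • X i :=
  SymmetricAlgebra.lift_ι_apply _ _

variable {D : Type*} [CommRing D] [Algebra D R] [Algebra D A] [IsScalarTower D R A]

theorem map_mem_deformation (v : deformation D φ) :
    (fun i => algebraMap D R (v.1 i)) ∈ deformation R φ :=
  (mem_deformation R φ).2 ⟨deformationMap D φ v, fun i => by
    rw [deformationMap_spec, IsScalarTower.algebraMap_apply D R A]⟩

variable (D)

/-- The map of symmetric algebras of deformations that is induced by a ring homomorphism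
`D → R` over `A`. -/
def symTransition :
    SymmetricAlgebra D (deformation D φ) →+* SymmetricAlgebra R (deformation R φ) :=
  letI : Algebra D (SymmetricAlgebra R (deformation R φ)) :=
    ((algebraMap R (SymmetricAlgebra R (deformation R φ))).comp (algebraMap D R)).toAlgebra
  (SymmetricAlgebra.lift (R := D) (M := deformation D φ)
    (A := SymmetricAlgebra R (deformation R φ))
    { toFun := fun v => SymmetricAlgebra.ι R _ ⟨_, map_mem_deformation R φ v⟩
      map_add' := fun v w => by
        rw [← map_add]
        exact congrArg _ (Subtype.ext (funext fun i => map_add _ _ _))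
      map_smul' := fun r v => by
        refine Eq.trans ?_ (Algebra.smul_def _ _).symm
        refine Eq.trans ?_ (Algebra.smul_def (algebraMap D R r) _)
        rw [← map_smul]
        exact congrArg _ (Subtype.ext (funext fun i => map_mul _ _ _)) }).toRingHom

theorem symTransition_ι (v : deformation D φ) :
    symTransition R φ D (SymmetricAlgebra.ι D _ v) =
      SymmetricAlgebra.ι R _ ⟨_, map_mem_deformation R φ v⟩ := by
  let _ : Algebra D (SymmetricAlgebra R (deformation R φ)) :=
    ((algebraMap R (SymmetricAlgebra R (deformation R φ))).comp (algebraMap D R)).toAlgebra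
  exact SymmetricAlgebra.lift_ι_apply (R := D) (A := SymmetricAlgebra R (deformation R φ)) _ v

theorem symTransition_algebraMap (r : D) :
    symTransition R φ D (algebraMap D _ r) = algebraMap R _ (algebraMap D R r) := by
  let _ : Algebra D (SymmetricAlgebra R (deformation R φ)) :=
    ((algebraMap R (SymmetricAlgebra R (deformation R φ))).comp (algebraMap D R)).toAlgebra
  exact AlgHom.commutes
    (SymmetricAlgebra.lift (R := D) (A := SymmetricAlgebra R (deformation R φ)) _) r

theorem symDeformationMap_comp_symTransition :
    (symDeformationMap R φ).comp (symTransition R φ D) = symDeformationMap D φ := by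
  refine SymmetricAlgebra.ringHom_ext (fun r => ?_) fun v => ?_
  · rw [RingHom.comp_apply, symTransition_algebraMap, symDeformationMap_algebraMap,
      symDeformationMap_algebraMap, IsScalarTower.algebraMap_apply D R A]
  · rw [RingHom.comp_apply, symTransition_ι, symDeformationMap_ι, symDeformationMap_ι]
    congr 1
    rw [deformationMap_eq_iff]
    intro i
    rw [deformationMap_spec, IsScalarTower.algebraMap_apply D R A]

theorem symCoord_comp_symTransition [Fintype ι] :
    (symCoord R φ).toRingHom.comp (symTransition R φ D) =
      (MvPolynomial.map (algebraMap D R)).comp (symCoord D φ).toRingHom := by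
  refine SymmetricAlgebra.ringHom_ext (fun r => ?_) fun v => ?_
  · simp only [RingHom.comp_apply, AlgHom.toRingHom_eq_coe, RingHom.coe_coe,
      symTransition_algebraMap, AlgHom.commutes, MvPolynomial.algebraMap_eq, MvPolynomial.map_C]
  · simp only [RingHom.comp_apply, AlgHom.toRingHom_eq_coe, RingHom.coe_coe,
      symTransition_ι, symCoord_ι, map_sum, smul_eq_C_mul, map_mul, MvPolynomial.map_C,
      MvPolynomial.map_X]

/-- The symmetric algebra of `E` embeds into the `D`-embedded Aluffi algebra if `D` is a domain
which maps, over `A`, to a ring `R` for which `S_R(𝐄) → R[X]` is injective. -/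
theorem symToAluffi_injective_of_symCoord_injective [Fintype ι] [IsDomain D]
    (h : Function.Injective (symCoord R φ)) : Function.Injective (symToAluffi D φ) := by
  refine symToAluffi_injective D φ ?_
  rintro z ⟨a, ha, hz⟩
  -- Torsion dies in D[X], which is torsion-free over the domain D. By naturality the image of `z`
  -- in R[X] is zero as well.
  have h0 : symCoord D φ z = 0 := by
    have := congrArg (symCoord D φ) hz
    rw [map_smul, map_zero] at this
    exact (smul_eq_zero.1 this).resolve_left (nonZeroDivisors.ne_zero ha)
  have h1 : symTransition R φ D z = 0 := by
    refine h ?_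
    rw [map_zero]
    refine (RingHom.congr_fun (symCoord_comp_symTransition R φ D) z).trans ?_
    simp [h0]
  rw [← symDeformationMap_comp_symTransition R φ D, RingHom.comp_apply, h1, map_zero]

end General

/-- This makes the scaling of all variables by a nonzero `d` visibly injective over a domain. -/
theorem MvPolynomial.coeff_aeval_C_mul_X {R σ : Type*} [CommRing R] (d : R)
    (p : MvPolynomial σ R) (m : σ →₀ ℕ) :
    coeff m (aeval (fun j => C d * X j : σ → MvPolynomial σ R) p) = d ^ m.degree * coeff m p := by
  classical
  induction p using MvPolynomial.induction_on' with
  | add p q hp hq => rw [map_add, coeff_add, coeff_add, hp, hq, mul_add]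
  | monomial s a =>
    have : aeval (fun j => C d * X j : σ → MvPolynomial σ R) (monomial s a) =
        monomial s (d ^ s.degree * a) := by
      rw [aeval_monomial, Finsupp.prod, Finset.prod_congr rfl fun i _ => mul_pow (C d) (X i) (s i),
        Finset.prod_mul_distrib, Finset.prod_pow_eq_pow_sum, algebraMap_eq, ← mul_assoc, ← map_pow,
        ← map_mul, mul_comm a, monomial_eq]
      rfl
    rw [this, coeff_monomial, coeff_monomial]
    split_ifs with hs
    · rw [hs]
    · rw [mul_zero]

section Cover

variable {k : Type u} [Field k]

/-- Take one block of variables for k[x] and one for generators of `C.R`. Each map is the evident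
one on its own block, and sends the other block to lifts of the images in `A`. -/
theorem exists_common_polynomial_cover {n : ℕ} {A : Type u} [CommRing A] [Algebra k A]
    [Algebra (MvPolynomial (Fin n) k) A] [IsScalarTower k (MvPolynomial (Fin n) k) A]
    (hA : Function.Surjective (algebraMap (MvPolynomial (Fin n) k) A)) (C : FiniteTypeCover k A) :
    ∃ (m : ℕ) (g : MvPolynomial (Fin n ⊕ Fin m) k →ₐ[k] MvPolynomial (Fin n) k)
      (h : MvPolynomial (Fin n ⊕ Fin m) k →ₐ[k] C.R),
      Function.Surjective g ∧ Function.Surjective h ∧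
        ∀ r, algebraMap C.R A (h r) = algebraMap (MvPolynomial (Fin n) k) A (g r) := by
  obtain ⟨m, c, hc⟩ := Algebra.FiniteType.iff_quotient_mvPolynomial''.1 C.finiteType
  choose y hy using fun j : Fin m => hA (algebraMap C.R A (c (X j)))
  choose z hz using fun i : Fin n => C.surjective (algebraMap (MvPolynomial (Fin n) k) A (X i))
  refine ⟨m, aeval (Sum.elim X y), aeval (Sum.elim z fun j => c (X j)), fun p => ?_, fun p => ?_,
    fun r => ?_⟩
  · refine ⟨rename Sum.inl p, ?_⟩
    rw [aeval_rename, Sum.elim_comp_inl, aeval_X_left_apply]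
  · obtain ⟨p, rfl⟩ := hc p
    refine ⟨rename Sum.inr p, ?_⟩
    rw [aeval_rename, Sum.elim_comp_inr]
    exact AlgHom.congr_fun (aeval_unique c).symm p
  · have : (IsScalarTower.toAlgHom k C.R A).comp (aeval (Sum.elim z fun j => c (X j))) =
        (IsScalarTower.toAlgHom k (MvPolynomial (Fin n) k) A).comp (aeval (Sum.elim X y)) := by
      refine MvPolynomial.algHom_ext fun i => ?_
      rcases i with i | j
      · simpa using hz i
      · simpa using (hy j).symm
    exact AlgHom.congr_fun this r

/-- A compatible family is determined by its component at the polynomial cover `P`. For another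
cover `C`, a polynomial ring `D` dominates both; since S_A(E) injects into the algebras at `P` and
at `D`, the lift found at `P` is also the lift for D → C. -/
theorem symToAbsoluteAluffi_bijective {n : ℕ} {A : Type u} [CommRing A] [Algebra k A]
    [Algebra (MvPolynomial (Fin n) k) A] [IsScalarTower k (MvPolynomial (Fin n) k) A]
    (hA : Function.Surjective (algebraMap (MvPolynomial (Fin n) k) A))
    {E ι : Type*} [Fintype ι] [AddCommGroup E] [Module A E] (φ : FreeEmbedding A E ι)
    (hφ : Function.Injective (symCoord (MvPolynomial (Fin n) k) φ)) :
    Function.Bijective (symToAbsoluteAluffi k φ) := by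
  have hinj : Function.Injective (symToAluffi (MvPolynomial (Fin n) k) φ) :=
    symToAluffi_injective_of_symCoord_injective (MvPolynomial (Fin n) k) φ _ hφ
  let P : FiniteTypeCover k A := { R := MvPolynomial (Fin n) k, surjective := hA }
  refine ⟨fun s t h => hinj ?_, fun x => ?_⟩
  · exact congrFun (congrArg Subtype.val h) P
  · obtain ⟨s, hs⟩ := symToAluffi_surjective P.R φ (x.1 P)
    refine ⟨s, Subtype.ext (funext fun C => ?_)⟩
    change symToAluffi C.R φ s = x.1 C
    obtain ⟨m, g, h, hg, hh, hgh⟩ := exists_common_polynomial_cover hA C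
    let _ : Algebra (MvPolynomial (Fin n ⊕ Fin m) k) (MvPolynomial (Fin n) k) :=
      g.toRingHom.toAlgebra
    let _ : Algebra (MvPolynomial (Fin n ⊕ Fin m) k) A :=
      ((algebraMap (MvPolynomial (Fin n) k) A).comp g.toRingHom).toAlgebra
    have : IsScalarTower (MvPolynomial (Fin n ⊕ Fin m) k) (MvPolynomial (Fin n) k) A :=
      IsScalarTower.of_algebraMap_eq fun _ => rfl
    have : IsScalarTower k (MvPolynomial (Fin n ⊕ Fin m) k) A :=
      IsScalarTower.of_algebraMap_eq fun r => by
        refine (IsScalarTower.algebraMap_apply k (MvPolynomial (Fin n) k) A r).trans ?_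
        exact congrArg _ (g.commutes r).symm
    let D : FiniteTypeCover k A :=
      { R := MvPolynomial (Fin n ⊕ Fin m) k
        surjective := hA.comp hg }
    have hD : Function.Injective (symToAluffi D.R φ) :=
      symToAluffi_injective_of_symCoord_injective (MvPolynomial (Fin n) k) φ
        (MvPolynomial (Fin n ⊕ Fin m) k) hφ
    -- Compatibility along D → P yields a lift equal to `s` by injectivity at `P`; the lift along D
    -- → C equals it by injectivity at `D`.
    obtain ⟨s', hs', hs''⟩ := x.2 D P g hg fun _ => rfl
    obtain rfl : s' = s := hinj (hs''.trans hs.symm)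
    obtain ⟨t, ht, ht'⟩ := x.2 D C h hh hgh
    obtain rfl : t = s' := hD (ht.trans hs'.symm)
    exact ht'

end Cover

end Aluffi

/-! ### Grade, height and prime avoidance -/

section GradeHeight

variable {S : Type u} [CommRing S]

open RingTheory.Sequence in
/-- A weakly regular sequence in a prime ideal is at most as long as the height of the prime. -/
theorem RingTheory.Sequence.IsWeaklyRegular.length_le_height {rs : List S}
    (h : IsWeaklyRegular S rs) {P : Ideal S} [P.IsPrime] (hP : Ideal.ofList rs ≤ P) :
    (rs.length : ℕ∞) ≤ P.height := by
  induction rs using List.reverseRecOn generalizing P with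
  | nil => simp
  | append_singleton rs r ih =>
    rw [isWeaklyRegular_append_iff, isWeaklyRegular_singleton_iff] at h
    rw [Ideal.ofList_append, sup_le_iff, Ideal.ofList_singleton, Ideal.span_singleton_le_iff_mem]
      at hP
    obtain ⟨Q, hQ, hQP⟩ := Ideal.exists_minimalPrimes_le hP.1
    have := hQ.isPrime
    -- `r` is a nonzerodivisor modulo the preceding elements, so it avoids every minimal prime over
    -- them; hence `Q` is strictly smaller than `P`.
    have hr : r ∉ Q := fun hrQ => by
      set I := Ideal.ofList rs with hI
      have hmk : Ideal.Quotient.mk I r ∈ nonZeroDivisors (S ⧸ I) := by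
        refine mem_nonZeroDivisors_iff_right.2 fun x hx => ?_
        obtain ⟨x, rfl⟩ := Ideal.Quotient.mk_surjective x
        have hreg := h.2
        rw [smul_eq_mul, Ideal.mul_top] at hreg
        rw [← map_mul, mul_comm] at hx
        exact hreg.right_eq_zero_of_smul hx
      rw [Ideal.minimalPrimes_eq_comap] at hQ
      obtain ⟨Q', hQ', rfl⟩ := hQ
      exact Set.disjoint_left.1 (Ideal.disjoint_nonZeroDivisors_of_mem_minimalPrimes hQ')
        hrQ hmk
    have hlt : Q < P := lt_of_le_of_ne hQP fun h => hr (h ▸ hP.2)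
    calc ((rs ++ [r]).length : ℕ∞) = rs.length + 1 := by simp
      _ ≤ Q.height + 1 := by gcongr; exact ih h.1 hQ.1.2
      _ ≤ P.height := Ideal.height_add_one_le_of_lt_of_isPrime hlt

theorem idealGrade_le_height (I : Ideal S) : idealGrade I ≤ I.height := by
  refine iSup_le fun rs => ?_
  rw [Ideal.height_eq_inf_minimalPrimes]
  refine le_iInf₂ fun P hP => ?_
  have := hP.isPrime
  refine rs.2.1.toIsWeaklyRegular.length_le_height (Ideal.span_le.2 fun r hr => ?_)
  exact hP.1.2 (rs.2.2 r hr)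

/-- Condition `hab` says that `b` is regular modulo `a`. Properness of `I` is needed since a regular
sequence must generate a proper ideal. -/
theorem two_le_idealGrade [IsDomain S] {I : Ideal S} (hI : I ≠ ⊤) {a b : S} (ha : a ∈ I)
    (hb : b ∈ I) (ha0 : a ≠ 0) (hab : ∀ x, a ∣ b * x → a ∣ x) : 2 ≤ idealGrade I := by
  refine le_iSup_of_le (ι := {rs : List S // RingTheory.Sequence.IsRegular S rs ∧ ∀ r ∈ rs, r ∈ I})
    ⟨[a, b], ⟨?_, ?_⟩, ?_⟩ (by simp)
  · rw [show [a, b] = [a] ++ [b] from rfl, RingTheory.Sequence.isWeaklyRegular_append_iff,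
      RingTheory.Sequence.isWeaklyRegular_singleton_iff,
      RingTheory.Sequence.isWeaklyRegular_singleton_iff]
    refine ⟨fun x y h => mul_left_cancel₀ ha0 h, ?_⟩
    rw [smul_eq_mul, Ideal.mul_top, Ideal.ofList_singleton]
    refine IsSMulRegular.of_right_eq_zero_of_smul fun x hx => ?_
    obtain ⟨x, rfl⟩ := Submodule.Quotient.mk_surjective _ x
    rw [← Submodule.Quotient.mk_smul, Submodule.Quotient.mk_eq_zero,
      Ideal.mem_span_singleton] at hx
    rw [Submodule.Quotient.mk_eq_zero, Ideal.mem_span_singleton]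
    exact hab x hx
  · rw [smul_eq_mul, Ideal.mul_top]
    intro h
    refine hI (eq_top_iff.2 (h.le.trans (Ideal.span_le.2 fun r hr => ?_)))
    rcases List.mem_cons.1 hr with rfl | hr
    · exact ha
    · rw [List.mem_singleton.1 hr]; exact hb
  · intro r hr
    rcases List.mem_cons.1 hr with rfl | hr
    · exact ha
    · rw [List.mem_singleton.1 hr]; exact hb

/-- An ideal that contains a nonzero element `d`, and that is not contained in any of the prime
ideals generated by the prime factors of `d`, has height at least two. -/
theorem two_le_height [IsDomain S] [UniqueFactorizationMonoid S] {I : Ideal S} {d : S}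
    (hd : d ∈ I) (hd0 : d ≠ 0) (h : ∀ p, Prime p → p ∣ d → ¬ I ≤ Ideal.span {p}) :
    2 ≤ I.height := by
  rw [Ideal.height_eq_inf_minimalPrimes]
  refine le_iInf₂ fun P hP => ?_
  have hPp := hP.isPrime
  -- A prime over `I` contains some prime factor `p` of `d`, which gives the chain 0 < (p) < P.
  obtain ⟨p, hp, hpd, hpP⟩ : ∃ p, Prime p ∧ p ∣ d ∧ p ∈ P := by
    have hmem : (UniqueFactorizationMonoid.factors d).prod ∈ P := by
      obtain ⟨u, hu⟩ := (UniqueFactorizationMonoid.factors_prod hd0).symm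
      rw [← hu]
      exact P.mul_mem_right _ (hP.1.2 hd)
    obtain ⟨p, hp, hpP⟩ := (Ideal.IsPrime.multiset_prod_mem_iff_exists_mem hPp _).1 hmem
    exact ⟨p, UniqueFactorizationMonoid.prime_of_factor p hp,
      UniqueFactorizationMonoid.dvd_of_mem_factors hp, hpP⟩
  have hpI : (Ideal.span {p}).IsPrime := (Ideal.span_singleton_prime hp.ne_zero).2 hp
  have h1 : (⊥ : Ideal S) < Ideal.span {p} :=
    bot_lt_iff_ne_bot.2 fun h => hp.ne_zero (Ideal.span_singleton_eq_bot.1 h)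
  have h2 : Ideal.span {p} < P :=
    lt_of_le_of_ne ((Ideal.span_singleton_le_iff_mem _).2 hpP)
      fun he => h p hp hpd (he ▸ hP.1.2)
  have : (⊥ : Ideal S).IsPrime := Ideal.isPrime_bot
  calc (2 : ℕ∞) = 0 + 1 + 1 := by norm_num
    _ ≤ (⊥ : Ideal S).height + 1 + 1 := by gcongr; exact zero_le
    _ ≤ (Ideal.span {p}).height + 1 := by
        gcongr; exact Ideal.height_add_one_le_of_lt_of_isPrime h1
    _ ≤ P.height := Ideal.height_add_one_le_of_lt_of_isPrime h2

/-- Prime avoidance: an ideal that is not contained in any of the prime ideals generated by the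
prime factors of a squarefree element `d` contains a nonzerodivisor modulo `d`. -/
theorem exists_mem_forall_dvd_mul_imp [IsDomain S] [UniqueFactorizationMonoid S] {I : Ideal S}
    {d : S} (hd : Squarefree d) (h : ∀ p, Prime p → p ∣ d → ¬ I ≤ Ideal.span {p}) :
    ∃ b ∈ I, ∀ x, d ∣ b * x → d ∣ x := by
  classical
  have hpr : ∀ p ∈ (UniqueFactorizationMonoid.factors d).toFinset, Prime p ∧ p ∣ d :=
    fun p hp => ⟨UniqueFactorizationMonoid.prime_of_factor p (Multiset.mem_toFinset.1 hp),
      UniqueFactorizationMonoid.dvd_of_mem_factors (Multiset.mem_toFinset.1 hp)⟩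
  have hav : ¬ (I : Set S) ⊆ ⋃ p ∈ ((UniqueFactorizationMonoid.factors d).toFinset : Set S),
      (Ideal.span {p} : Ideal S) := by
    rw [Ideal.subset_union_prime 0 0 fun p hp _ _ =>
      (Ideal.span_singleton_prime (hpr p hp).1.ne_zero).2 (hpr p hp).1]
    rintro ⟨p, hp, hI⟩
    exact h p (hpr p hp).1 (hpr p hp).2 hI
  obtain ⟨b, hb, hb'⟩ := Set.not_subset.1 hav
  refine ⟨b, hb, fun x hx => hd.dvd_of_forall_prime_dvd fun p hp hpd => ?_⟩
  refine (hp.dvd_or_dvd (hpd.trans hx)).resolve_left fun hpb => hb' ?_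
  obtain ⟨q, hq, hpq⟩ := UniqueFactorizationMonoid.exists_mem_factors_of_dvd hd.ne_zero
    hp.irreducible hpd
  refine Set.mem_biUnion (Multiset.mem_toFinset.2 hq) ?_
  exact Ideal.mem_span_singleton.2 (hpq.symm.dvd.trans hpb)

/-- If `c I` is contained in an ideal generated by two elements and no power of `c` is, then `I`
has height at most two. -/
theorem height_le_two [IsNoetherianRing S] {I : Ideal S} {a b c : S}
    (h : ∀ x ∈ I, c * x ∈ Ideal.span {a, b}) (hc : ∀ N : ℕ, c ^ N ∉ Ideal.span {a, b}) :
    I.height ≤ 2 := by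
  classical
  have hc' : c ∉ (Ideal.span {a, b}).radical := fun ⟨N, hN⟩ => hc N hN
  rw [← Ideal.sInf_minimalPrimes, Submodule.mem_sInf] at hc'
  push Not at hc'
  -- A minimal prime over the two generators that omits `c` must contain `I`; Krull's height theorem
  -- bounds its height by 2.
  obtain ⟨Q, hQ, hcQ⟩ := hc'
  have := hQ.isPrime
  have hIQ : I ≤ Q := fun x hx => (this.mem_or_mem (hQ.1.2 (h x hx))).resolve_left hcQ
  refine (Ideal.height_mono hIQ).trans ?_
  have h2 := Ideal.height_le_card_of_mem_minimalPrimes_span_finset (s := {a, b}) (p := Q)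
    (by simpa using hQ)
  exact h2.trans (by exact_mod_cast Finset.card_le_two)

end GradeHeight

/-! ### Projective dimension from short free resolutions -/

section ProjectiveDimension

open CategoryTheory

variable {S : Type u} [CommRing S]

theorem hasProjectiveDimensionLT_two_of_ker {F G N : Type u} [AddCommGroup F] [Module S F]
    [AddCommGroup G] [Module S G] [AddCommGroup N] [Module S N] [Module.Projective S F]
    [Module.Projective S G] {a : F →ₗ[S] G} {b : G →ₗ[S] N} (ha : Function.Injective a)
    (hb : Function.Surjective b) (h : LinearMap.ker b = LinearMap.range a) :
    HasProjectiveDimensionLT (ModuleCat.of S N) 2 := by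
  have e : F ≃ₗ[S] LinearMap.ker b :=
    (LinearEquiv.ofInjective a ha).trans (LinearEquiv.ofEq _ _ h.symm)
  have hk : Module.Projective S (LinearMap.ker b) := Module.Projective.of_equiv e
  have h1 : Projective (ModuleCat.of S (LinearMap.ker b)) :=
    (IsProjective.iff_projective _).1 hk
  have h2 : Projective (ModuleCat.of S G) := (IsProjective.iff_projective _).1 inferInstance
  exact (LinearMap.shortExact_shortComplexKer hb).hasProjectiveDimensionLT_X₃ 1
    (inferInstanceAs (HasProjectiveDimensionLT (ModuleCat.of S (LinearMap.ker b)) 1))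
    (inferInstanceAs (HasProjectiveDimensionLT (ModuleCat.of S G) 2))

theorem projectiveDimension_eq_one {F G N : Type u} [AddCommGroup F] [Module S F]
    [AddCommGroup G] [Module S G] [AddCommGroup N] [Module S N] [Module.Projective S F]
    [Module.Projective S G] {a : F →ₗ[S] G} {b : G →ₗ[S] N} (ha : Function.Injective a)
    (hb : Function.Surjective b) (h : LinearMap.ker b = LinearMap.range a)
    (hN : ¬ Module.Projective S N) : projectiveDimension (ModuleCat.of S N) = 1 := by
  refine le_antisymm ?_ ?_
  · exact (projectiveDimension_le_iff _ 1).2 (hasProjectiveDimensionLT_two_of_ker ha hb h)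
  · refine (projectiveDimension_ge_iff _ 1).2 fun h => hN ?_
    exact (IsProjective.iff_projective _).2 (projective_iff_hasProjectiveDimensionLT_one.2 h)

theorem projectiveDimension_quotient_eq_two {I : Ideal S} {F G : Type u} [AddCommGroup F]
    [Module S F] [AddCommGroup G] [Module S G] [Module.Projective S F]
    [Module.Projective S G] {a : F →ₗ[S] G} {b : G →ₗ[S] I} (ha : Function.Injective a)
    (hb : Function.Surjective b) (h : LinearMap.ker b = LinearMap.range a)
    (hI : ¬ Module.Projective S I) : projectiveDimension (ModuleCat.of S (S ⧸ I)) = 2 := by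
  have hker : LinearMap.ker I.mkQ = I := I.ker_mkQ
  have e : I ≃ₗ[S] LinearMap.ker I.mkQ := LinearEquiv.ofEq _ _ hker.symm
  have hex := LinearMap.shortExact_shortComplexKer I.mkQ_surjective
  have hS : Projective (ModuleCat.of S S) := (IsProjective.iff_projective _).1 inferInstance
  refine le_antisymm ?_ ?_
  · refine (projectiveDimension_le_iff _ 2).2 ?_
    have := hasProjectiveDimensionLT_two_of_ker ha hb h
    exact hex.hasProjectiveDimensionLT_X₃ 2
      (hasProjectiveDimensionLT_of_iso e.toModuleIso 2)
      (inferInstanceAs (HasProjectiveDimensionLT (ModuleCat.of S S) 3))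
  -- If S/I had projective dimension at most one, its first syzygy `I` would be projective.
  · refine (projectiveDimension_ge_iff _ 2).2 fun h2 => hI ?_
    have h1 : HasProjectiveDimensionLT (ModuleCat.of S (LinearMap.ker I.mkQ)) 1 :=
      hex.hasProjectiveDimensionLT_X₁ 1
        (inferInstanceAs (HasProjectiveDimensionLT (ModuleCat.of S S) 1)) h2
    have := (IsProjective.iff_projective (R := S) (LinearMap.ker I.mkQ)).2
      (projective_iff_hasProjectiveDimensionLT_one.2 h1)
    exact Module.Projective.of_equiv e.symm

/-- If the cokernel of `a` is projective and `a` is injective, then `a` has a retraction. -/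
theorem exists_retraction_of_projective {F G N : Type*} [AddCommGroup F] [Module S F]
    [AddCommGroup G] [Module S G] [AddCommGroup N] [Module S N] [Module.Projective S N]
    {a : F →ₗ[S] G} {b : G →ₗ[S] N} (ha : Function.Injective a)
    (hb : Function.Surjective b) (h : LinearMap.ker b = LinearMap.range a) :
    ∃ r : G →ₗ[S] F, r ∘ₗ a = LinearMap.id := by
  obtain ⟨s, hs⟩ := Module.projective_lifting_property b LinearMap.id hb
  have hex : Function.Exact a b := fun x => by
    rw [← LinearMap.mem_ker, h]; rfl
  have h01 : (∃ l, b ∘ₗ l = LinearMap.id) ↔ ∃ l, l ∘ₗ a = LinearMap.id :=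
    (hex.split_tfae ha hb).out 0 1
  exact h01.1 ⟨s, hs⟩

end ProjectiveDimension

/-! ### The ideal of maximal minors: height, grade and resolution -/

section MinorsIdeal

open scoped Matrix

variable {R : Type u} [CommRing R] {n : ℕ}

/-- The ideal of `R[U]` generated by the maximal minors of the matrix with first row `U`, stacked
over the matrix `A` over `R`. -/
def minorsIdeal (A : Matrix (Fin n) (Fin n) R) : Ideal (MvPolynomial (Fin n) R) :=
  Ideal.span (Set.range (stackMinors X (A.map C)))

theorem det_map_C (A : Matrix (Fin n) (Fin n) R) :
    (A.map (C : R →+* MvPolynomial (Fin n) R)).det = C A.det :=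
  (RingHom.map_det C A).symm

theorem adjugate_map_C (A : Matrix (Fin n) (Fin n) R) :
    (A.map (C : R →+* MvPolynomial (Fin n) R)).adjugate = A.adjugate.map C :=
  (RingHom.map_adjugate C A).symm

theorem X_vecMul_adjugate_map_C (A : Matrix (Fin n) (Fin n) R) (i : Fin n) :
    ((X : Fin n → MvPolynomial (Fin n) R) ᵥ* (A.map C).adjugate) i =
      ∑ l, C (A.adjugate l i) * X l := by
  rw [adjugate_map_C]
  simp only [Matrix.vecMul, dotProduct, Matrix.map_apply]
  exact Finset.sum_congr rfl fun l _ => mul_comm _ _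

/-- The cofactors are the coefficients of the linear forms, so divisibility of a form by a constant
can be tested on them. -/
theorem coeff_X_vecMul_adjugate (A : Matrix (Fin n) (Fin n) R) (i l : Fin n) :
    coeff (Finsupp.single l 1) (((X : Fin n → MvPolynomial (Fin n) R) ᵥ* (A.map C).adjugate) i) =
      A.adjugate l i := by
  classical
  rw [X_vecMul_adjugate_map_C, coeff_sum, Finset.sum_eq_single l]
  · rw [coeff_C_mul, coeff_X, if_pos rfl, mul_one]
  · intro j _ hj
    rw [coeff_C_mul, coeff_X, if_neg, mul_zero]
    exact fun h => hj ((Finsupp.single_left_injective one_ne_zero) h)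
  · simp

theorem C_det_mem_minorsIdeal (A : Matrix (Fin n) (Fin n) R) : C A.det ∈ minorsIdeal A :=
  Ideal.subset_span ⟨0, by rw [← det_map_C]; rfl⟩

theorem X_vecMul_mem_minorsIdeal (A : Matrix (Fin n) (Fin n) R) (i : Fin n) :
    (X ᵥ* (A.map C).adjugate) i ∈ minorsIdeal A := by
  rw [← neg_mem_iff]
  exact Ideal.subset_span ⟨i.succ, rfl⟩

theorem minorsIdeal_le {A : Matrix (Fin n) (Fin n) R} {J : Ideal (MvPolynomial (Fin n) R)}
    (h : C A.det ∈ J) (h' : ∀ i, (X ᵥ* (A.map C).adjugate) i ∈ J) : minorsIdeal A ≤ J := by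
  refine Ideal.span_le.2 ?_
  rintro _ ⟨i, rfl⟩
  refine Fin.cases ?_ (fun i => ?_) i
  · rw [SetLike.mem_coe, stackMinors, Fin.cons_zero, det_map_C]
    exact h
  · rw [SetLike.mem_coe, stackMinors, Fin.cons_succ, Pi.neg_apply, neg_mem_iff]
    exact h' i

/-- Evaluation of `R[U]` at `U = 0` followed by a homomorphism of `R`. -/
def evalZero {K : Type*} [CommRing K] (ε : R →+* K) : MvPolynomial (Fin n) R →+* K :=
  eval₂Hom ε 0

/-- At U = 0 the linear forms vanish, so any zero of the determinant gives a zero of the whole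
ideal. -/
theorem minorsIdeal_ne_top {A : Matrix (Fin n) (Fin n) R} {K : Type*} [CommRing K] [Nontrivial K]
    (ε : R →+* K) (hε : ε A.det = 0) : minorsIdeal A ≠ ⊤ := fun h => by
  have hle : minorsIdeal A ≤ RingHom.ker (evalZero ε) := by
    refine minorsIdeal_le ?_ fun i => ?_
    · rw [RingHom.mem_ker, evalZero, coe_eval₂Hom, eval₂_C, hε]
    · rw [X_vecMul_adjugate_map_C, RingHom.mem_ker, map_sum]
      refine Finset.sum_eq_zero fun l _ => ?_
      rw [map_mul, evalZero, eval₂Hom_X', Pi.zero_apply, mul_zero]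
  rw [h, top_le_iff] at hle
  exact RingHom.ker_ne_top _ hle

section Domain

variable [IsDomain R]

theorem MvPolynomial.squarefree_C {σ : Type*} {d : R} (hd : Squarefree d) (hd0 : d ≠ 0) :
    Squarefree (C d : MvPolynomial σ R) := by
  intro x hx
  obtain ⟨b, -, rfl⟩ := (dvd_C_iff_exists hd0).1 ((dvd_mul_right x x).trans hx)
  rw [← map_mul, C_dvd_iff_dvd_coeff] at hx
  have := hx 0
  rw [coeff_zero_C] at this
  exact (hd b this).map C

/-- Over a domain, divisors of a nonzero constant are constants, so `p` comes from `R` and the claim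
reduces to `exists_not_dvd_adjugate`. -/
theorem exists_not_dvd_X_vecMul_adjugate {A : Matrix (Fin n) (Fin n) R} (hA : Squarefree A.det)
    (hA0 : A.det ≠ 0) {p : MvPolynomial (Fin n) R} (hp : Prime p) (hpA : p ∣ C A.det) :
    ∃ i, ¬ p ∣ (X ᵥ* (A.map C).adjugate) i := by
  obtain ⟨b, hb, rfl⟩ := (dvd_C_iff_exists hA0).1 hpA
  obtain ⟨l, i, h⟩ := exists_not_dvd_adjugate hA ((prime_C_iff _).1 hp) hb
  refine ⟨i, fun hi => h ?_⟩
  rw [← coeff_X_vecMul_adjugate]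
  exact (C_dvd_iff_dvd_coeff _ _).1 hi _

theorem not_minorsIdeal_le_span {A : Matrix (Fin n) (Fin n) R} (hA : Squarefree A.det)
    (hA0 : A.det ≠ 0) (p : MvPolynomial (Fin n) R) (hp : Prime p) (hpA : p ∣ C A.det) :
    ¬ minorsIdeal A ≤ Ideal.span {p} := fun h => by
  obtain ⟨i, hi⟩ := exists_not_dvd_X_vecMul_adjugate hA hA0 hp hpA
  exact hi (Ideal.mem_span_singleton.1 (h (X_vecMul_mem_minorsIdeal A i)))

theorem mem_range_stackRow_X_iff [UniqueFactorizationMonoid R] {A : Matrix (Fin n) (Fin n) R}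
    (hA : Squarefree A.det) (hA0 : A.det ≠ 0) (a : Fin (n + 1) → MvPolynomial (Fin n) R) :
    (∃ c, stackRow X (A.map C) *ᵥ c = a) ↔ ∑ i, a i * stackMinors X (A.map C) i = 0 := by
  have h0 : (A.map (C : R →+* MvPolynomial (Fin n) R)).det ≠ 0 := by
    rw [det_map_C]
    exact fun h => hA0 (C_eq_zero.1 h)
  refine mem_range_stackRow_iff X h0 (fun b hb => ?_) a
  rw [det_map_C] at hb ⊢
  refine (squarefree_C hA hA0).dvd_of_forall_prime_dvd fun p hp hpA => ?_
  obtain ⟨i, hi⟩ := exists_not_dvd_X_vecMul_adjugate hA hA0 hp hpA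
  exact (hp.dvd_or_dvd (hpA.trans (hb i))).resolve_left hi

/-- Pick a cofactor c = adj(A)ₘᵢ prime to p. The 2 × 2 minors of the adjugate are divisible by det
A, so c Lⱼ ≡ adj(A)ₘⱼ Lᵢ modulo det A for the linear forms L, and c times the ideal lies in (p, Lᵢ).
-/
theorem height_minorsIdeal_le_two [IsNoetherianRing R] {A : Matrix (Fin n) (Fin n) R}
    (hA : Squarefree A.det) {p : R} (hp : Prime p) (hpA : p ∣ A.det) :
    (minorsIdeal A).height ≤ 2 := by
  obtain ⟨m, i, hmi⟩ := exists_not_dvd_adjugate hA hp hpA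
  set L := (X : Fin n → MvPolynomial (Fin n) R) ᵥ* (A.map C).adjugate with hL
  refine height_le_two (a := C p) (b := L i) (c := C (A.adjugate m i)) ?_ fun N hN => ?_
  · suffices minorsIdeal A ≤ Submodule.comap
        (LinearMap.mulLeft (MvPolynomial (Fin n) R) (C (A.adjugate m i))) (Ideal.span {C p, L i}) from fun x hx => this hx
    have hdet : ∀ x, C A.det * x ∈ Ideal.span {C p, L i} := fun x =>
      Ideal.mem_span_pair.2 (by
        obtain ⟨q, hq⟩ := hpA
        exact ⟨C q * x, 0, by rw [hq, map_mul]; ring⟩)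
    refine minorsIdeal_le (J := Submodule.comap
        (LinearMap.mulLeft (MvPolynomial (Fin n) R) (C (A.adjugate m i))) (Ideal.span {C p, L i})) ?_ fun j => ?_
    · change C (A.adjugate m i) * C A.det ∈ Ideal.span {C p, L i}
      rw [mul_comm]
      exact hdet _
    · change C (A.adjugate m i) * L j ∈ Ideal.span {C p, L i}
      obtain ⟨c, hc⟩ := (A.map C).exists_vecMul_adjugate_mul_eq X
        (Pi.single j 1 : Fin n → MvPolynomial (Fin n) R) i
      have hcm := hc m
      rw [Matrix.dotProduct_mulVec, dotProduct_single_one, Matrix.mulVec_single_one, det_map_C,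
        ← hL, adjugate_map_C] at hcm
      have : C (A.adjugate m i) * L j = L i * C (A.adjugate m j) - C A.det * c m := by
        rw [eq_sub_iff_add_eq', mul_comm (C (A.adjugate m i))]
        exact hcm.symm
      rw [this]
      refine sub_mem (Ideal.mul_mem_right _ _ (Ideal.subset_span (by simp))) (hdet _)
  · rw [Ideal.mem_span_pair] at hN
    obtain ⟨s, t, hst⟩ := hN
    have hI : (Ideal.span {p}).IsPrime := (Ideal.span_singleton_prime hp.ne_zero).2 hp
    set φ := Ideal.Quotient.mk (Ideal.span {p}) with hφ
    have hφ0 : ∀ {x}, φ x = 0 ↔ p ∣ x := fun {x} => by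
      rw [hφ, Ideal.Quotient.eq_zero_iff_mem, Ideal.mem_span_singleton]
    -- Modulo p, the form Lᵢ would divide a nonzero constant and so be constant, but its coefficient
    -- at Uₘ is c, which is nonzero modulo p.
    have hst' := congrArg (MvPolynomial.map φ) hst
    rw [map_add, map_mul, map_mul, map_C, hφ0.2 dvd_rfl, map_zero, mul_zero, zero_add, map_pow,
      map_C, ← map_pow] at hst'
    have hα : φ (A.adjugate m i) ≠ 0 := fun h => hmi (hφ0.1 h)
    obtain ⟨b, -, hb⟩ := (dvd_C_iff_exists (pow_ne_zero N hα)).1 (Dvd.intro_left _ hst')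
    refine hα ?_
    rw [← coeff_X_vecMul_adjugate, ← coeff_map, ← hL, hb, coeff_C, if_neg]
    exact fun h => one_ne_zero (Finsupp.single_eq_zero.1 h.symm)

theorem height_minorsIdeal [IsNoetherianRing R] [UniqueFactorizationMonoid R]
    {A : Matrix (Fin n) (Fin n) R} (hA : Squarefree A.det) (hA0 : A.det ≠ 0)
    (hAu : ¬ IsUnit A.det) : (minorsIdeal A).height = 2 := by
  obtain ⟨p, hp, hpA⟩ := WfDvdMonoid.exists_irreducible_factor hAu hA0
  refine le_antisymm (height_minorsIdeal_le_two hA hp.prime hpA) ?_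
  exact two_le_height (C_det_mem_minorsIdeal A) (fun h => hA0 (C_eq_zero.1 h))
    (not_minorsIdeal_le_span hA hA0)

theorem idealGrade_minorsIdeal [IsNoetherianRing R] [UniqueFactorizationMonoid R]
    {A : Matrix (Fin n) (Fin n) R} (hA : Squarefree A.det) (hA0 : A.det ≠ 0)
    (hAu : ¬ IsUnit A.det) (hI : minorsIdeal A ≠ ⊤) : idealGrade (minorsIdeal A) = 2 := by
  refine le_antisymm ((idealGrade_le_height _).trans_eq (height_minorsIdeal hA hA0 hAu)) ?_
  obtain ⟨b, hb, hb'⟩ := exists_mem_forall_dvd_mul_imp (squarefree_C hA hA0)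
    (not_minorsIdeal_le_span hA hA0)
  exact two_le_idealGrade hI (C_det_mem_minorsIdeal A) hb (fun h => hA0 (C_eq_zero.1 h)) hb'

/-- A matrix which acquires a kernel under a surjective ring homomorphism has no left inverse. -/
theorem not_exists_retraction {S K : Type*} [CommRing S] [CommRing K] {m : ℕ} (ε : S →+* K)
    {M : Matrix (Fin m) (Fin n) S} {v : Fin n → K} (hv : v ≠ 0)
    (hM : M.map ε *ᵥ v = 0) :
    ¬ ∃ r : (Fin m → S) →ₗ[S] (Fin n → S), r ∘ₗ M.mulVecLin = LinearMap.id := by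
  rintro ⟨r, hr⟩
  have hP : LinearMap.toMatrix' r * M = 1 := by
    have := congrArg LinearMap.toMatrix' hr
    rwa [LinearMap.toMatrix'_comp, LinearMap.toMatrix'_id, ← Matrix.toLin'_apply',
      LinearMap.toMatrix'_toLin'] at this
  have hP' := congrArg (fun N : Matrix _ _ S => N.map ε *ᵥ v) hP
  simp only [Matrix.map_mul, ← Matrix.mulVec_mulVec, hM, Matrix.mulVec_zero] at hP'
  rw [Matrix.map_one _ (map_zero ε) (map_one ε), Matrix.one_mulVec] at hP'
  exact hv hP'.symm

/-- The signed maximal minors, as elements of the ideal that they generate. -/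
def minorsIdealGenerator (A : Matrix (Fin n) (Fin n) R) (i : Fin (n + 1)) : minorsIdeal A :=
  ⟨stackMinors X (A.map C) i, Ideal.subset_span ⟨i, rfl⟩⟩

theorem isPresentationMatrix_stackRow [UniqueFactorizationMonoid R] {A : Matrix (Fin n) (Fin n) R}
    (hA : Squarefree A.det) (hA0 : A.det ≠ 0) :
    IsPresentationMatrix (stackRow X (A.map C)) (minorsIdealGenerator A) := by
  constructor
  · refine Submodule.map_injective_of_injective (minorsIdeal A).injective_subtype ?_
    rw [Submodule.map_span, ← Set.range_comp, Submodule.map_top, Submodule.range_subtype]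
    rfl
  · ext a
    rw [LinearMap.mem_ker, LinearMap.mem_range]
    refine Iff.trans ?_ (mem_range_stackRow_X_iff hA hA0 a).symm
    rw [Fintype.linearCombination_apply, Subtype.ext_iff, AddSubmonoidClass.coe_finsetSum]
    rfl

theorem IsPresentationMatrix.surjective {S N m p : Type*} [CommRing S] [AddCommGroup N]
    [Module S N] [Fintype m] [Fintype p] {M : Matrix m p S} {g : m → N}
    (h : IsPresentationMatrix M g) : Function.Surjective (Fintype.linearCombination S g) := by
  rw [← LinearMap.range_eq_top, Fintype.range_linearCombination]
  exact h.1

/-- The Hilbert–Burch resolution gives the upper bound. Were the ideal projective, the stacked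
matrix would have a left inverse; but at U = 0 its first row vanishes, and under `ε` the square part
becomes singular. -/
theorem projectiveDimension_quotient_minorsIdeal [UniqueFactorizationMonoid R]
    {A : Matrix (Fin n) (Fin n) R} (hA : Squarefree A.det) (hA0 : A.det ≠ 0)
    {K : Type*} [CommRing K] [IsDomain K] (ε : R →+* K) (hε : ε A.det = 0) :
    CategoryTheory.projectiveDimension
      (ModuleCat.of (MvPolynomial (Fin n) R) (MvPolynomial (Fin n) R ⧸ minorsIdeal A)) = 2 := by
  have hpres := isPresentationMatrix_stackRow hA hA0
  have hinj : Function.Injective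
      (stackRow (X : Fin n → MvPolynomial (Fin n) R) (A.map C)).mulVecLin :=
    stackRow_mulVecLin_injective X (by rw [det_map_C]; exact fun h => hA0 (C_eq_zero.1 h))
  refine projectiveDimension_quotient_eq_two hinj hpres.surjective hpres.2 fun hproj => ?_
  obtain ⟨v, hv, hv0⟩ := Matrix.exists_mulVec_eq_zero_iff (M := A.map ε) |>.2
    (by rw [← hε, RingHom.map_det]; rfl)
  refine not_exists_retraction (evalZero ε) hv ?_
    (exists_retraction_of_projective hinj hpres.surjective hpres.2)
  funext i
  refine Fin.cases ?_ (fun i => ?_) i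
  · change ∑ l, evalZero ε (X l) * v l = 0
    exact Finset.sum_eq_zero fun l _ => by
      rw [evalZero, eval₂Hom_X', Pi.zero_apply, zero_mul]
  · refine Eq.trans ?_ (congrFun hv0 i)
    change ∑ l, evalZero ε (C (A i l)) * v l = ∑ l, ε (A i l) * v l
    simp only [evalZero, coe_eval₂Hom, eval₂_C]

end Domain

end MinorsIdeal

/-! ### Weighted homogeneity of the minors -/

section Homogeneity

open scoped Matrix

variable {k : Type u} [Field k] {n : ℕ}

theorem MvPolynomial.IsHomogeneous.det {σ R : Type*} [CommRing R]
    {A : Matrix (Fin n) (Fin n) (MvPolynomial σ R)} {w : Fin n → ℕ}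
    (h : ∀ i j, (A i j).IsHomogeneous (w j)) : A.det.IsHomogeneous (∑ j, w j) := by
  rw [Matrix.det_apply]
  refine IsHomogeneous.sum _ _ _ fun s _ => ?_
  rw [← mem_homogeneousSubmodule, Units.smul_def]
  exact zsmul_mem (IsHomogeneous.prod _ _ _ fun i _ => h _ _) _

/-- The cofactor is the determinant with column `l` replaced by a unit vector, whose entries have
degree 0; this accounts for the updated weight. -/
theorem MvPolynomial.IsHomogeneous.adjugate {σ R : Type*} [CommRing R]
    {A : Matrix (Fin n) (Fin n) (MvPolynomial σ R)} {w : Fin n → ℕ}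
    (h : ∀ i j, (A i j).IsHomogeneous (w j)) (l i : Fin n) :
    (A.adjugate l i).IsHomogeneous (∑ j, Function.update w l 0 j) := by
  have : A.adjugate l i = (A.updateCol l (Pi.single i 1)).det := by
    rw [← Matrix.cramer_apply, Matrix.cramer_eq_adjugate_mulVec, Matrix.mulVec_single_one]
    rfl
  rw [this]
  refine IsHomogeneous.det fun r j => ?_
  rw [Matrix.updateCol_apply, Function.update_apply]
  split_ifs with hj
  · rw [Pi.single_apply]
    split_ifs
    · exact isHomogeneous_one _ _
    · exact isHomogeneous_zero _ _ _
  · exact h r j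

theorem MvPolynomial.IsHomogeneous.rename_inr {σ τ R : Type*} [CommRing R] (w : σ → ℕ)
    {p : MvPolynomial τ R} {N : ℕ} (h : p.IsHomogeneous N) :
    IsWeightedHomogeneous (Sum.elim w fun _ => 1) (rename (Sum.inr : τ → σ ⊕ τ) p) N := by
  rw [p.as_sum, map_sum]
  refine IsWeightedHomogeneous.sum _ _ _ fun d hd => ?_
  rw [rename_monomial]
  refine isWeightedHomogeneous_monomial _ _ _ ?_
  refine Eq.trans ?_ (h (mem_support_iff.1 hd))
  rw [Finsupp.weight_apply, Finsupp.weight_apply, Finsupp.sum_mapDomain_index (by simp)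
    (by simp [add_mul])]
  rfl

theorem sumAlgEquiv_symm_C {σ τ R : Type*} [CommRing R] (p : MvPolynomial τ R) :
    (sumAlgEquiv R σ τ).symm (C p) = rename Sum.inr p := by
  rw [AlgEquiv.symm_apply_eq]
  exact (AlgHom.congr_fun (sumAlgEquiv_comp_rename_inr R σ τ) p).symm

attribute [local instance] MvPolynomial.weightedGradedAlgebra in
theorem isQuasiHomogeneousIdeal_span {w : Fin n → ℕ}
    {s : Set (MvPolynomial (Fin n) (MvPolynomial (Fin n) k))}
    (hs : ∀ p ∈ s, ∃ N, IsWeightedHomogeneous (Sum.elim w fun _ : Fin n => 1)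
      ((sumAlgEquiv k (Fin n) (Fin n)).symm p) N) :
    IsQuasiHomogeneousIdeal w (Ideal.span s) := by
  intro p hp N
  set φ := sumAlgEquiv k (Fin n) (Fin n) with hφ
  set W : Fin n ⊕ Fin n → ℕ := Sum.elim w fun _ => 1 with hW
  have hhom : (Ideal.span (φ.symm '' s)).IsHomogeneous (weightedHomogeneousSubmodule k W) := by
    refine Ideal.homogeneous_span _ _ ?_
    rintro _ ⟨q, hq, rfl⟩
    exact hs q hq
  have hmem : φ.symm p ∈ Ideal.span (φ.symm '' s) := by
    rw [← Ideal.map_span]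
    exact Ideal.mem_map_of_mem _ hp
  have := weightedHomogeneousComponent_mem_of_mem k W hhom hmem N
  have h2 := Ideal.mem_map_of_mem φ this
  rw [Ideal.map_span, Set.image_image] at h2
  simpa using h2

/-- All the generators have weight ∑ wⱼ: in adj(A)ₗᵢ Uₗ the variable restores the weight wₗ that the
cofactor lost. -/
theorem isQuasiHomogeneousIdeal_minorsIdeal {w : Fin n → ℕ}
    {A : Matrix (Fin n) (Fin n) (MvPolynomial (Fin n) k)}
    (h : ∀ i j, (A i j).IsHomogeneous (w j)) : IsQuasiHomogeneousIdeal w (minorsIdeal A) := by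
  refine isQuasiHomogeneousIdeal_span ?_
  rintro _ ⟨i, rfl⟩
  refine ⟨∑ j, w j, ?_⟩
  refine Fin.cases ?_ (fun i => ?_) i
  · rw [stackMinors, Fin.cons_zero, det_map_C, sumAlgEquiv_symm_C]
    exact (IsHomogeneous.det h).rename_inr w
  · rw [stackMinors, Fin.cons_succ, Pi.neg_apply, X_vecMul_adjugate_map_C, map_neg, map_sum]
    refine IsWeightedHomogeneous.neg (IsWeightedHomogeneous.sum _ _ _ fun l _ => ?_)
    rw [map_mul, sumAlgEquiv_symm_C, sumAlgEquiv_symm_X]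
    have hsum : ∑ j, Function.update w l 0 j + w l = ∑ j, w j := by
      rw [Finset.sum_update_of_mem (Finset.mem_univ l), zero_add, add_comm,
        Finset.sdiff_singleton_eq_erase, Finset.add_sum_erase _ _ (Finset.mem_univ l)]
    rw [← hsum]
    exact ((IsHomogeneous.adjugate h l i).rename_inr w).mul
      (isWeightedHomogeneous_X k (Sum.elim w fun _ : Fin n => 1) (Sum.inl l))

end Homogeneity

/-! ### Presentations of Der(A), its symmetric algebra and the Aluffi algebra -/

section Presentation

open scoped Matrix

variable {k : Type u} [Field k] {n : ℕ} {f : MvPolynomial (Fin n) k}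

theorem MvPolynomial.IsHomogeneous.constantCoeff_eq_zero {σ R : Type*} [CommSemiring R]
    {p : MvPolynomial σ R} {d : ℕ} (h : p.IsHomogeneous d) (hd : d ≠ 0) :
    constantCoeff p = 0 :=
  h.coeff_eq_zero (by simpa using hd.symm)

/-- A homomorphism from the symmetric algebra over `A`, a quotient of `R`, can be defined by
lifting relations over `R`. -/
theorem SymmetricAlgebra.exists_ringHom {R A E T ι : Type*} [CommRing R] [CommRing A]
    [Algebra R A] [AddCommGroup E] [Module R E] [Module A E] [IsScalarTower R A E] [CommRing T]
    [Algebra R T] [Fintype ι] (hA : Function.Surjective (algebraMap R A)) {g : ι → E} {t : ι → T}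
    (hg : Function.Surjective (Fintype.linearCombination R g))
    (h : LinearMap.ker (Fintype.linearCombination R g) ≤
      LinearMap.ker (Fintype.linearCombination R t))
    (α : A →+* T) (hα : ∀ r, α (algebraMap R A r) = algebraMap R T r) :
    ∃ θ : SymmetricAlgebra A E →+* T,
      (∀ a, θ (algebraMap A _ a) = α a) ∧ ∀ j, θ (SymmetricAlgebra.ι A E (g j)) = t j := by
  classical
  let l : E →ₗ[R] T := ((LinearMap.ker (Fintype.linearCombination R g)).liftQ _ h).comp
    (LinearMap.quotKerEquivOfSurjective _ hg).symm.toLinearMap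
  have hl : ∀ j, l (g j) = t j := fun j => by
    have h1 : Fintype.linearCombination R g (Pi.single j 1) = g j := by
      rw [Fintype.linearCombination_apply_single, one_smul]
    have h2 : (LinearMap.quotKerEquivOfSurjective _ hg).symm (g j) =
        Submodule.Quotient.mk (Pi.single j 1) := by
      rw [LinearEquiv.symm_apply_eq]
      exact h1.symm
    change (LinearMap.ker (Fintype.linearCombination R g)).liftQ _ h
      ((LinearMap.quotKerEquivOfSurjective _ hg).symm (g j)) = _
    rw [h2]
    refine (Submodule.liftQ_apply _ _ _).trans ?_
    rw [Fintype.linearCombination_apply_single, one_smul]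
  let _ : Algebra A T := α.toAlgebra
  have : IsScalarTower R A T := IsScalarTower.of_algebraMap_eq fun r => (hα r).symm
  let lA : E →ₗ[A] T := LinearMap.extendScalarsOfSurjective hA l
  exact ⟨(SymmetricAlgebra.lift lA).toRingHom, (SymmetricAlgebra.lift lA).commutes,
    fun j => (SymmetricAlgebra.lift_ι_apply lA _).trans (hl j)⟩

theorem deformationMap_logDerEquiv (δ : logDer f) :
    deformationMap (MvPolynomial (Fin n) k) (derEmbedding f) (logDerEquiv f δ) =
      logDerDescend f δ :=
  (deformationMap_eq_iff _ _).2 fun i => logDerDescend_mk f δ (X i)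

theorem logDerDescend_surjective : Function.Surjective (logDerDescend f) := fun x => by
  obtain ⟨v, rfl⟩ := deformationMap_surjective (MvPolynomial (Fin n) k) (derEmbedding f)
    Ideal.Quotient.mk_surjective x
  obtain ⟨δ, rfl⟩ := (logDerEquiv f).surjective v
  exact ⟨δ, (deformationMap_logDerEquiv δ).symm⟩

theorem logDerDescend_eq_zero_iff {δ : logDer f} :
    logDerDescend f δ = 0 ↔ ∀ i, f ∣ δ.1 (X i) := by
  rw [← (derEmbedding f).injective.eq_iff, map_zero, funext_iff]
  refine forall_congr' fun i => ?_
  rw [← Ideal.mem_span_singleton, ← Ideal.Quotient.eq_zero_iff_mem, ← logDerDescend_mk]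
  rfl

variable (e : Module.Basis (Fin n) (MvPolynomial (Fin n) k) (logDer f))

theorem linearCombination_logDerDescend (c : Fin n → MvPolynomial (Fin n) k) :
    Fintype.linearCombination (MvPolynomial (Fin n) k) (fun j => logDerDescend f (e j)) c =
      logDerDescend f (∑ j, c j • e j) := by
  rw [Fintype.linearCombination_apply, map_sum]
  exact Finset.sum_congr rfl fun j _ => (map_smul _ _ _).symm

theorem linearCombination_logDerDescend_surjective : Function.Surjective
    (Fintype.linearCombination (MvPolynomial (Fin n) k) fun j => logDerDescend f (e j)) :=
  fun x => by
    obtain ⟨δ, rfl⟩ := logDerDescend_surjective x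
    exact ⟨e.repr δ, by rw [linearCombination_logDerDescend, e.sum_repr]⟩

/-- By Saito, c is a relation iff 𝓔c = det 𝓔 • v for some v. Multiplying by adj 𝓔 and cancelling the
determinant gives c = adj 𝓔 v, and conversely. -/
theorem isPresentationMatrix_adjugate [CharZero k] (hf : Squarefree f) :
    IsPresentationMatrix (basisMatrix e).adjugate fun j => logDerDescend f (e j) := by
  refine ⟨?_, ?_⟩
  · rw [← Fintype.range_linearCombination, LinearMap.range_eq_top]
    exact linearCombination_logDerDescend_surjective e
  · have hdet := det_basisMatrix_ne_zero e hf
    ext c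
    rw [LinearMap.mem_ker, linearCombination_logDerDescend, logDerDescend_eq_zero_iff,
      LinearMap.mem_range]
    simp only [← basisMatrix_mulVec, (associated_det_basisMatrix e hf).dvd_iff_dvd_left,
      Matrix.mulVecLin_apply]
    constructor
    · intro h
      choose v hv using h
      refine ⟨v, funext fun i => mul_left_cancel₀ hdet ?_⟩
      have h2 := congrArg ((basisMatrix e).adjugate *ᵥ ·)
        (show basisMatrix e *ᵥ c = (basisMatrix e).det • v from funext hv)
      simp only [Matrix.mulVec_mulVec, Matrix.adjugate_mul, Matrix.smul_mulVec, Matrix.one_mulVec,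
        Matrix.mulVec_smul] at h2
      exact (congrFun h2 i).symm
    · rintro ⟨v, rfl⟩ i
      rw [Matrix.mulVec_mulVec, Matrix.mul_adjugate, Matrix.smul_mulVec, Matrix.one_mulVec]
      exact dvd_mul_right _ _

theorem adjugate_mulVecLin_injective [CharZero k] (hf : Squarefree f) :
    Function.Injective (basisMatrix e).adjugate.mulVecLin := by
  refine Matrix.mulVec_injective_of_det_ne_zero ?_
  rw [Matrix.det_adjugate]
  exact pow_ne_zero _ (det_basisMatrix_ne_zero e hf)

theorem smul_hypersurfaceDer (x : HypersurfaceDer f) : f • x = 0 := by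
  obtain ⟨δ, rfl⟩ := logDerDescend_surjective x
  rw [← map_smul, logDerDescend_eq_zero_iff]
  exact fun i => dvd_mul_right _ _

theorem exists_hypersurfaceDer_ne_zero [CharZero k] {d : ℕ} (hf : f.IsHomogeneous d) (hd : 2 ≤ d)
    (hred : Squarefree f) : ∃ x : HypersurfaceDer f, x ≠ 0 := by
  have hf0 := hred.ne_zero
  have hfu : ¬ IsUnit f := fun h => by
    have := h.map (constantCoeff (R := k) (σ := Fin n))
    rw [hf.constantCoeff_eq_zero (by omega)] at this
    exact not_isUnit_zero this
  obtain ⟨p, hp, hpf⟩ := WfDvdMonoid.exists_irreducible_factor hfu hf0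
  -- Only the existence of a variable is needed here.
  obtain ⟨i, -⟩ := hred.exists_not_dvd_pderiv hp.prime hpf
  -- The Euler derivation is logarithmic, and the degree-d polynomial f with d ≥ 2 cannot divide its
  -- coordinate xᵢ.
  have heuler : mkDerivation k X ∈ logDer f := by
    rw [mem_logDer_iff, derivation_apply_eq_sum]
    simp only [mkDerivation_X, hf.sum_X_mul_pderiv]
    exact ⟨d, by rw [nsmul_eq_mul, mul_comm]⟩
  refine ⟨logDerDescend f ⟨_, heuler⟩, fun h => ?_⟩
  have := logDerDescend_eq_zero_iff.1 h i
  rw [mkDerivation_X] at this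
  have hdeg := totalDegree_le_of_dvd_of_isDomain this (X_ne_zero i)
  rw [hf.totalDegree hf0, totalDegree_X] at hdeg
  omega

/-- Der(A) is nonzero and killed by f, so it has no section into a free R-module and is not
projective. -/
theorem projectiveDimension_hypersurfaceDer [CharZero k]
    (e : Module.Basis (Fin n) (MvPolynomial (Fin n) k) (logDer f)) {d : ℕ} (hf : f.IsHomogeneous d)
    (hd : 2 ≤ d) (hred : Squarefree f) :
    CategoryTheory.projectiveDimension
      (ModuleCat.of (MvPolynomial (Fin n) k) (HypersurfaceDer f)) = 1 := by
  have hpres := isPresentationMatrix_adjugate e hred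
  refine projectiveDimension_eq_one (adjugate_mulVecLin_injective e hred) hpres.surjective hpres.2
    fun hproj => ?_
  obtain ⟨s, hs⟩ := Module.projective_lifting_property _ LinearMap.id hpres.surjective
  obtain ⟨x, hx⟩ := exists_hypersurfaceDer_ne_zero hf hd hred
  have h0 : f • s x = 0 := by rw [← map_smul, smul_hypersurfaceDer, map_zero]
  refine hx ?_
  have := LinearMap.congr_fun hs x
  rw [LinearMap.comp_apply, (smul_eq_zero.1 h0).resolve_left hred.ne_zero, map_zero] at this
  exact this.symm

/-- The map `R[U] → S_A(E)` that sends `Uⱼ` to the derivation induced by `eⱼ`. -/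
def symPresentation : MvPolynomial (Fin n) (MvPolynomial (Fin n) k) →+*
    SymmetricAlgebra (HypersurfaceRing f) (HypersurfaceDer f) :=
  eval₂Hom ((algebraMap (HypersurfaceRing f) _).comp (Ideal.Quotient.mk (Ideal.span {f})))
    fun j => SymmetricAlgebra.ι _ _ (logDerDescend f (e j))

/-- This moves the computation of the kernel from the Aluffi algebra to S_A(E). -/
theorem aluffiPresentation_eq_comp :
    aluffiPresentation e =
      (symToAluffi (MvPolynomial (Fin n) k) (derEmbedding f)).comp (symPresentation e) := by
  refine MvPolynomial.ringHom_ext (fun r => ?_) fun j => ?_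
  · have h1 : reesPresentation e (C r) = Ideal.Quotient.mk _ (algebraMap _ _ r) :=
      (reesPresentation e).commutes r
    have h2 : symPresentation e (C r) = algebraMap _ _ (Ideal.Quotient.mk (Ideal.span {f}) r) :=
      eval₂Hom_C _ _ _
    rw [RingHom.comp_apply, h2]
    refine (congrArg (reesToAluffi _ _) h1).trans ?_
    rw [reesToAluffi_mk, symDeformationMap_algebraMap]
    rfl
  · have h1 : reesPresentation e (X j) =
        Ideal.Quotient.mk _ (SymmetricAlgebra.ι _ _ (logDerEquiv f (e j))) := aeval_X _ _
    have h2 : symPresentation e (X j) = SymmetricAlgebra.ι _ _ (logDerDescend f (e j)) :=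
      eval₂Hom_X' _ _ _
    rw [RingHom.comp_apply, h2]
    refine (congrArg (reesToAluffi _ _) h1).trans ?_
    rw [reesToAluffi_mk, symDeformationMap_ι, deformationMap_logDerEquiv]

theorem symPresentation_linear (c : Fin n → MvPolynomial (Fin n) k) :
    symPresentation e (∑ j, C (c j) * X j) = SymmetricAlgebra.ι _ _
      (Fintype.linearCombination (MvPolynomial (Fin n) k) (fun j => logDerDescend f (e j)) c) := by
  rw [Fintype.linearCombination_apply, map_sum, map_sum]
  refine Finset.sum_congr rfl fun j _ => ?_
  rw [map_mul, symPresentation, eval₂Hom_C, eval₂Hom_X', RingHom.comp_apply, ← Algebra.smul_def,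
    ← map_smul]
  rfl

theorem minorsIdeal_le_ker_symPresentation [CharZero k] (hf : Squarefree f) :
    minorsIdeal (basisMatrix e) ≤ RingHom.ker (symPresentation e) := by
  refine minorsIdeal_le ?_ fun i => ?_
  · rw [RingHom.mem_ker, symPresentation, eval₂Hom_C, RingHom.comp_apply,
      Ideal.Quotient.eq_zero_iff_mem.2 (Ideal.mem_span_singleton.2 (dvd_det_basisMatrix e hf)),
      map_zero]
  · rw [RingHom.mem_ker, X_vecMul_adjugate_map_C, symPresentation_linear]
    have hmem : (basisMatrix e).adjugate.mulVecLin (Pi.single i 1) ∈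
        LinearMap.ker (Fintype.linearCombination (MvPolynomial (Fin n) k)
          fun j => logDerDescend f (e j)) := by
      rw [(isPresentationMatrix_adjugate e hf).2]
      exact LinearMap.mem_range_self _ _
    rw [LinearMap.mem_ker, Matrix.mulVecLin_apply, Matrix.mulVec_single_one] at hmem
    exact (congrArg _ hmem).trans (map_zero _)

theorem linearCombination_mk_X {R : Type*} [CommRing R] (I : Ideal (MvPolynomial (Fin n) R))
    (c : Fin n → R) :
    Fintype.linearCombination R (fun j => Ideal.Quotient.mk I (X j)) c =
      Ideal.Quotient.mk I (∑ j, C (c j) * X j) := by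
  rw [Fintype.linearCombination_apply, map_sum]
  refine Finset.sum_congr rfl fun j _ => ?_
  rw [← smul_eq_C_mul]
  rfl

theorem range_adjugate_le_ker {R : Type*} [CommRing R] (A : Matrix (Fin n) (Fin n) R) :
    LinearMap.range A.adjugate.mulVecLin ≤
      LinearMap.ker (Fintype.linearCombination R
        fun j => Ideal.Quotient.mk (minorsIdeal A) (X j)) := by
  rintro _ ⟨v, rfl⟩
  rw [LinearMap.mem_ker, Matrix.mulVecLin_apply, linearCombination_mk_X,
    Ideal.Quotient.eq_zero_iff_mem]
  have : ∑ j, C ((A.adjugate *ᵥ v) j) * X j =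
      ∑ i, C (v i) * (X ᵥ* (A.map C).adjugate) i := by
    simp only [X_vecMul_adjugate_map_C, Matrix.mulVec, dotProduct, map_sum, map_mul,
      Finset.sum_mul, Finset.mul_sum]
    rw [Finset.sum_comm]
    exact Finset.sum_congr rfl fun i _ => Finset.sum_congr rfl fun j _ => by ring
  rw [this]
  exact sum_mem fun i _ => Ideal.mul_mem_left _ _ (X_vecMul_mem_minorsIdeal _ i)

theorem isScalarTower_hypersurfaceDer :
    IsScalarTower (MvPolynomial (Fin n) k) (HypersurfaceRing f) (HypersurfaceDer f) :=
  ⟨fun a b c => Derivation.ext fun x => smul_assoc a b (c x)⟩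

/-- The presentation of Der(A) by adj 𝓔, with f = 0 in R[U]/𝔄, yields a map S_A(E) → R[U]/𝔄 whose
composite with R[U] → S_A(E) is the quotient map. -/
theorem ker_symPresentation_le [CharZero k] (hf : Squarefree f) :
    RingHom.ker (symPresentation e) ≤ minorsIdeal (basisMatrix e) := by
  set I := minorsIdeal (basisMatrix e) with hI
  have hα : ∀ a ∈ Ideal.span {f}, (Ideal.Quotient.mk I).comp C a = 0 := fun a ha => by
    rw [RingHom.comp_apply, Ideal.Quotient.eq_zero_iff_mem]
    obtain ⟨b, rfl⟩ := (associated_det_basisMatrix e hf).dvd_iff_dvd_left.1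
      (Ideal.mem_span_singleton.1 ha)
    rw [map_mul]
    exact Ideal.mul_mem_right _ _ (C_det_mem_minorsIdeal _)
  have hpres := isPresentationMatrix_adjugate e hf
  have hle := hpres.2.le.trans (range_adjugate_le_ker _)
  have hlift : ∀ r, Ideal.Quotient.lift (Ideal.span {f}) _ hα
      (algebraMap (MvPolynomial (Fin n) k) (HypersurfaceRing f) r) =
        algebraMap (MvPolynomial (Fin n) k) (_ ⧸ I) r := fun r => Ideal.Quotient.lift_mk _ _ _
  have hA : Function.Surjective (algebraMap (MvPolynomial (Fin n) k) (HypersurfaceRing f)) :=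
    Ideal.Quotient.mk_surjective
  have := isScalarTower_hypersurfaceDer (f := f)
  obtain ⟨θ, hθ, hθ'⟩ := SymmetricAlgebra.exists_ringHom (E := HypersurfaceDer f)
    (T := MvPolynomial (Fin n) (MvPolynomial (Fin n) k) ⧸ I)
    (g := fun j => logDerDescend f (e j)) (t := fun j => Ideal.Quotient.mk I (X j)) hA
    hpres.surjective hle _ hlift
  have hcomp : θ.comp (symPresentation e) = Ideal.Quotient.mk I := by
    refine MvPolynomial.ringHom_ext (fun r => ?_) fun j => ?_
    · rw [RingHom.comp_apply, symPresentation, eval₂Hom_C]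
      exact hθ _
    · rw [RingHom.comp_apply, symPresentation, eval₂Hom_X', hθ']
  intro x hx
  rw [← Ideal.Quotient.eq_zero_iff_mem, ← hcomp, RingHom.comp_apply, RingHom.mem_ker.1 hx,
    map_zero]

theorem ker_aluffiPresentation [CharZero k] (hf : Squarefree f) :
    RingHom.ker (aluffiPresentation e) = minorsIdeal (basisMatrix e) := by
  have : Module.Free (MvPolynomial (Fin n) k)
      (deformation (MvPolynomial (Fin n) k) (derEmbedding f)) :=
    Module.Free.of_basis (e.map (logDerEquiv f))
  have hker : RingHom.ker (aluffiPresentation e) = RingHom.ker (symPresentation e) := by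
    rw [aluffiPresentation_eq_comp, RingHom.ker_comp_of_injective]
    exact (symToAluffi_bijective (MvPolynomial (Fin n) k) (derEmbedding f)).1
  rw [hker]
  exact le_antisymm (ker_symPresentation_le e hf) (minorsIdeal_le_ker_symPresentation e hf)

theorem reesPresentation_bijective : Function.Bijective (reesPresentation e) := by
  set b := e.map (logDerEquiv f) with hb
  have : Module.Free (MvPolynomial (Fin n) k)
      (deformation (MvPolynomial (Fin n) k) (derEmbedding f)) := Module.Free.of_basis b
  have hmk : Function.Bijective (Ideal.Quotient.mk (symTorsion (MvPolynomial (Fin n) k)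
      (deformation (MvPolynomial (Fin n) k) (derEmbedding f)))) := by
    refine ⟨?_, Ideal.Quotient.mk_surjective⟩
    rw [RingHom.injective_iff_ker_eq_bot, Ideal.mk_ker, symTorsion_eq_bot]
  have heq : ∀ x, reesPresentation e x =
      Ideal.Quotient.mk _ ((SymmetricAlgebra.equivMvPolynomial b).symm x) := by
    have : reesPresentation e = (Ideal.Quotient.mkₐ (MvPolynomial (Fin n) k) _).comp
        (SymmetricAlgebra.equivMvPolynomial b).symm.toAlgHom :=
      MvPolynomial.algHom_ext fun j => by
        refine (aeval_X _ _).trans ?_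
        refine congrArg (Ideal.Quotient.mk _) ?_
        exact (SymmetricAlgebra.equivMvPolynomial_symm_X b j).symm
    exact fun x => AlgHom.congr_fun this x
  rw [show (reesPresentation e : _ → _) = _ from funext heq]
  exact hmk.comp (SymmetricAlgebra.equivMvPolynomial b).symm.bijective

theorem aluffiPresentation_surjective : Function.Surjective (aluffiPresentation e) :=
  (reesToAluffi_surjective _ (derEmbedding f) Ideal.Quotient.mk_surjective).comp
    (reesPresentation_bijective e).2

/-- In the basis, the map is the substitution Uⱼ ↦ ∑ 𝓔ᵢⱼ Xᵢ. Following it with the substitution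
given by adj 𝓔 scales each variable by det 𝓔 ≠ 0, which is injective. -/
theorem symCoord_injective [CharZero k]
    (e : Module.Basis (Fin n) (MvPolynomial (Fin n) k) (logDer f)) (hf : Squarefree f) :
    Function.Injective (symCoord (MvPolynomial (Fin n) k) (derEmbedding f)) := by
  set b := e.map (logDerEquiv f) with hb
  let adj : MvPolynomial (Fin n) (MvPolynomial (Fin n) k) →ₐ[MvPolynomial (Fin n) k]
      MvPolynomial (Fin n) (MvPolynomial (Fin n) k) :=
    aeval fun i => ∑ l, C ((basisMatrix e).adjugate l i) * X l
  have hcomp : (adj.comp (symCoord _ _)).comp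
      (SymmetricAlgebra.equivMvPolynomial b).symm.toAlgHom =
        aeval fun j => C (basisMatrix e).det * X j := by
    refine MvPolynomial.algHom_ext fun j => ?_
    rw [aeval_X]
    have h1 : (SymmetricAlgebra.equivMvPolynomial b).symm.toAlgHom (X j) =
        SymmetricAlgebra.ι _ _ (b j) := SymmetricAlgebra.equivMvPolynomial_symm_X b j
    rw [AlgHom.comp_apply, h1, AlgHom.comp_apply, symCoord_ι, map_sum]
    have h2 : ∀ i, adj ((b j).1 i • X i) =
        ∑ l, C (basisMatrix e i j * (basisMatrix e).adjugate l i) * X l := fun i => by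
      rw [map_smul, aeval_X, Finset.smul_sum]
      refine Finset.sum_congr rfl fun l _ => ?_
      rw [smul_eq_C_mul, ← mul_assoc, ← map_mul]
      rfl
    simp only [h2]
    rw [Finset.sum_comm]
    simp only [← Finset.sum_mul, ← map_sum]
    have h3 : ∀ l, ∑ i, basisMatrix e i j * (basisMatrix e).adjugate l i =
        if l = j then (basisMatrix e).det else 0 := fun l => by
      have := congrFun (congrFun (basisMatrix e).adjugate_mul l) j
      rw [Matrix.smul_apply, Matrix.one_apply, smul_eq_mul, mul_ite, mul_one, mul_zero] at this
      rw [← this, Matrix.mul_apply]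
      exact Finset.sum_congr rfl fun i _ => mul_comm _ _
    simp only [h3, apply_ite C, map_zero, ite_mul, zero_mul, Finset.sum_ite_eq', Finset.mem_univ,
      if_true]
  have hinj : Function.Injective (aeval (R := MvPolynomial (Fin n) k)
      fun j : Fin n => C (basisMatrix e).det * X j) := by
    refine (injective_iff_map_eq_zero _).2 fun x hx => MvPolynomial.ext _ _ fun m => ?_
    have := congrArg (coeff m) hx
    rw [coeff_aeval_C_mul_X, coeff_zero] at this
    exact (mul_eq_zero.1 this).resolve_left (pow_ne_zero _ (det_basisMatrix_ne_zero e hf))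
  have h := hcomp ▸ hinj
  intro x y hxy
  obtain ⟨x, rfl⟩ := (SymmetricAlgebra.equivMvPolynomial b).symm.surjective x
  obtain ⟨y, rfl⟩ := (SymmetricAlgebra.equivMvPolynomial b).symm.surjective y
  exact congrArg _ (h (congrArg adj hxy))

end Presentation

end

/-! ### Assembly of the three parts -/

theorem proposition3p1 {k : Type u} [Field k] [CharZero k] {n d : ℕ}
    (f : MvPolynomial (Fin n) k) (hf : f.IsHomogeneous d) (hd : 2 ≤ d) (hred : Squarefree f)
    (hfree : Module.Free (MvPolynomial (Fin n) k) (logDer f)) :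
    -- (a) the canonical maps from the symmetric algebra to the Aluffi algebras are isomorphisms
    (Function.Bijective (symToAluffi (MvPolynomial (Fin n) k) (derEmbedding f)) ∧
      Function.Bijective (symToAbsoluteAluffi k (derEmbedding f))) ∧
    Nonempty (Module.Basis (Fin n) (MvPolynomial (Fin n) k) (logDer f)) ∧
    ∀ e : Module.Basis (Fin n) (MvPolynomial (Fin n) k) (logDer f),
      -- (b) the presentation of the Aluffi algebra and its presentation ideal
      (Function.Bijective (reesPresentation e) ∧
        Function.Surjective (aluffiPresentation e) ∧
        (RingHom.ker (aluffiPresentation e)).height = 2 ∧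
        IsPerfectIdeal (RingHom.ker (aluffiPresentation e)) ∧
        (∃ g : Fin (n + 1) → RingHom.ker (aluffiPresentation e),
          IsPresentationMatrix (stackedMatrix e) g) ∧
        Function.Injective (stackedMatrix e).mulVecLin ∧
        (∀ w : Fin n → ℕ, (∀ i j, (basisMatrix e i j).IsHomogeneous (w j)) →
          IsQuasiHomogeneousIdeal w (RingHom.ker (aluffiPresentation e)))) ∧
      -- (c) the presentation of the module of derivations over the polynomial ring
      (IsPresentationMatrix (basisMatrix e).adjugate (fun j => logDerDescend f (e j)) ∧
        Function.Injective (basisMatrix e).adjugate.mulVecLin ∧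
        CategoryTheory.projectiveDimension
          (ModuleCat.of (MvPolynomial (Fin n) k) (HypersurfaceDer f)) = 1) := by
  have hf0 : f ≠ 0 := hred.ne_zero
  obtain ⟨b⟩ := nonempty_basis_logDer hf0 hfree
  have hfreeDef : Module.Free (MvPolynomial (Fin n) k)
      (deformation (MvPolynomial (Fin n) k) (derEmbedding f)) :=
    Module.Free.of_basis (b.map (logDerEquiv f))
  refine ⟨⟨symToAluffi_bijective _ _, symToAbsoluteAluffi_bijective Ideal.Quotient.mk_surjective _
    (symCoord_injective b hred)⟩, ⟨b⟩, fun e => ?_⟩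
  have hsq := squarefree_det_basisMatrix e hred
  have hdet := det_basisMatrix_ne_zero e hred
  -- f has positive degree, so det 𝓔 vanishes at the origin; this point shows that the ideal is
  -- proper and that its resolution does not split.
  have hε : constantCoeff (basisMatrix e).det = 0 := by
    obtain ⟨g, hg⟩ := dvd_det_basisMatrix e hred
    rw [hg, map_mul, hf.constantCoeff_eq_zero (by omega), zero_mul]
  have hu : ¬ IsUnit (basisMatrix e).det := fun h => by
    have h0 := h.map (constantCoeff (R := k) (σ := Fin n))
    rw [hε] at h0
    exact not_isUnit_zero h0
  have hker := ker_aluffiPresentation e hred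
  refine ⟨⟨reesPresentation_bijective e, aluffiPresentation_surjective e, ?_, ?_, ?_, ?_, ?_⟩,
    isPresentationMatrix_adjugate e hred, adjugate_mulVecLin_injective e hred,
    projectiveDimension_hypersurfaceDer e hf hd hred⟩
  · rw [hker]
    exact height_minorsIdeal hsq hdet hu
  · rw [hker, IsPerfectIdeal, projectiveDimension_quotient_minorsIdeal hsq hdet constantCoeff hε,
      idealGrade_minorsIdeal hsq hdet hu (minorsIdeal_ne_top constantCoeff hε)]
    rfl
  · rw [hker]
    exact ⟨_, isPresentationMatrix_stackRow hsq hdet⟩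
  · refine stackRow_mulVecLin_injective X (A := (basisMatrix e).map C) ?_
    rw [det_map_C]
    exact fun h => hdet (C_eq_zero.1 h)
  · intro w hw
    rw [hker]
    exact isQuasiHomogeneousIdeal_minorsIdeal hw
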